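/- **Setting.** Let $X$ and $\mathbb A$ be Borel subsets of complete separable metric spaces. For each $x\in X$ let $A(x)\subseteq\mathbb A$ be a nonempty Borel set such that $\mathrm{Gr}(A)=\{(x,a): x\in X,\ a\in A(x)\}$ is a Borel subset of $X\times\mathbb A$ and contains the graph of a Borel function. Let $c:\mathrm{Gr}(A)\to[0,\infty)$ be Borel and let $q(\cdot\mid x,a)$, $(x,a)\in\mathrm{Gr}(A)$, be a Borel family of finite measures on $X$ with $\sup_{(x,a)\in \mathrm{Gr}(A)} q(X\mid x,a)<\infty$. A stationary policy is a Borel function $\phi:X\to\mathbb A$ with $\phi(x)\in A(x)$ for all $x$; for Borel $u\ge 0$ put $Q_\phi u(x)=\int_X u(y)\,q(dy\mid x,\phi(x))$. A transition kernel $\kappa$ is weakly continuous if $s\mapsto\int f(t)\,\kappa(dt\mid s)$ is continuous for every bounded continuous real function $f$. **Assumptions.** - (T) $V:X\to[1,\infty)$ is continuous and $K$ is a constant such that $\sum_{n\ge0}Q_\phi^nV(x)\le KV(x)$ for all stationary policies $\phi$ and all $x\in X$. - (WC i) Every $A(x)$ is compact, and for every open $U\subseteq\mathbb A$ the sets $\{x: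 A(x)\subseteq U\}$ and $\{x: A(x)\cap U\ne\emptyset\}$ are open. - (WC ii) $q$ is weakly continuous on $\mathrm{Gr}(A)$. - The function $(x,a)\mapsto\int_XV(y)\,q(dy\mid x,a)$ is continuous on $\mathrm{Gr}(A)$. **Weight functions.** Under these assumptions there is a continuous function $\mu:X\to[1,\infty)$ with $V\le\mu\le KV$ and $$\mu(x)\ \ge\ V(x)+\int_X\mu(y)\,q(dy\mid x,a)\qquad\text{for all }(x,a)\in\mathrm{Gr}(A).$$ **HV transformation.** Let $\mu$ be any such function and let $\tilde\beta\in[(K-1)/K,1)$. The transformed model has state space $\tilde X=X\cup\{\tilde x\}$, where $\tilde x\notin X$ is isolated from $X$, action space $\mathbb A\cup\{\tilde a\}$, action sets $\tilde A(x)=A(x)$ for $x\in X$ and $\tilde A(\tilde x)=\{\tilde a\}$, costs $\tilde c(x,a)=\mu(x)^{-1}c(x,a)$ on $\mathrm{Gr}(A)$ and $\tilde c(\tilde x,\tilde a)=0$, and $$\tilde p(B\mid x,a)=\frac1{\tilde\beta\mu(x)}\int_B\mu(y)\,q(dy\mid x,a)\quad(B\subseteq X\text{ Borel}),\qquad \tilde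 p(\{\tilde x\}\mid x,a)=1-\tilde p(X\mid x,a)$$ for $(x,a)\in\mathrm{Gr}(A)$, and $\tilde p(\{\tilde x\}\mid\tilde x,\tilde a)=1$. (If $\tilde\beta=0$, then $q$ is necessarily zero, and $\tilde p(\{\tilde x\}\mid x,a)=1$.) For a (randomized, history-dependent) policy $\pi$ of this model let $$\tilde v^\pi(x)=\mathbb E_x^\pi\sum_{n\ge0}\tilde\beta^{\,n}\,\tilde c(x_n,a_n)\in[0,\infty],\qquad \tilde v=\inf_\pi\tilde v^\pi ;$$ $\pi$ is $\tilde\beta$-optimal if $\tilde v^\pi(x)=\tilde v(x)$ for all $x\in\tilde X$. **Theorem.** Under the above assumptions, $\tilde p$ is a weakly continuous transition probability kernel. If, in addition, $c$ is lower semicontinuous on $\mathrm{Gr}(A)$, then the transformed model has a stationary $\tilde\beta$-optimal policy, and a stationary policy $\phi$ of the transformed model is $\tilde\beta$-optimal if and only if for all $x\in X$ $$\tilde v(x)=\tilde c(x,\phi(x))+\tilde\beta\int_X\tilde v(y)\,\tilde p(dy\mid x,\phi(x))=\min_{a\in A(x)}\Big[\tilde c(x,a)+\tilde\beta\int_X\tilde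 v(y)\,\tilde p(dy\mid x,a)\Big].$$ -/

import Mathlib

open MeasureTheory ProbabilityTheory
open scoped ENNReal NNReal

/-- A Markov decision process with state space `X` and action space `A`: the sets `avail x` of
available actions, a nonnegative Borel one-step cost and a Borel transition kernel, the latter two
defined on the set `Gr = {(x, a) | a ∈ avail x}` of feasible pairs, which is Borel and
contains the graph of a Borel function.  The kernel need not be a probability kernel. -/
structure MDP (X A : Type*) [MeasurableSpace X] [MeasurableSpace A] where
  avail : X → Set A
  measurableSet_gr : MeasurableSet {z : X × A | z.2 ∈ avail z.1}
  exists_selector : ∃ φ : X → A, Measurable φ ∧ ∀ x, φ x ∈ avail x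
  cost : {z : X × A | z.2 ∈ avail z.1} → ℝ≥0
  measurable_cost : Measurable cost
  kernel : Kernel {z : X × A | z.2 ∈ avail z.1} X

namespace MDP

section General

variable {X A : Type*} [MeasurableSpace X] [MeasurableSpace A] (M : MDP X A)

/-- The set of feasible state-action pairs. -/
abbrev Gr : Set (X × A) := {z : X × A | z.2 ∈ M.avail z.1}

/-- A feasible state-action pair as an element of `Gr`. -/
abbrev pair (x : X) (a : A) (h : a ∈ M.avail x) : M.Gr := ⟨(x, a), h⟩

/-- Histories up to epoch `n`: the past pairs `(x₀, a₀), …, (xₙ₋₁, aₙ₋₁)` and the current state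
`xₙ`. -/
abbrev Hist (X A : Type*) (n : ℕ) : Type _ := (Fin n → X × A) × X

/-- A (randomized, history-dependent) policy. -/
structure Policy where
  rule : (n : ℕ) → Kernel (Hist X A n) A
  markov : ∀ n, IsMarkovKernel (rule n)
  feasible : ∀ n (h : Hist X A n), rule n h (M.avail h.2) = 1

attribute [instance] Policy.markov

/-- A stationary policy: a Borel selector of the sets of available actions. -/
structure Stationary where
  act : X → A
  measurable_act : Measurable act
  mem_avail : ∀ x, act x ∈ M.avail x

lemma measurableSet_avail (x : X) : MeasurableSet (M.avail x) :=
  M.measurableSet_gr.preimage (measurable_prodMk_left (x := x))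

/-- A stationary policy `φ` selects `φ xₙ` at every epoch `n`. -/
noncomputable def Stationary.toPolicy {M : MDP X A} (φ : M.Stationary) : M.Policy where
  rule _ := Kernel.deterministic (fun h => φ.act h.2) (φ.measurable_act.comp measurable_snd)
  markov _ := inferInstance
  feasible n h := by
    rw [Kernel.deterministic_apply' _ _ (M.measurableSet_avail h.2)]
    simp [φ.mem_avail]

/-- The pair `(x, φ x)`. -/
abbrev Stationary.pair {M : MDP X A} (φ : M.Stationary) (x : X) : M.Gr :=
  M.pair x (φ.act x) (φ.mem_avail x)

/-- `Q_φ u (x) = ∫ u(y) q(dy | x, φ(x))`, for nonnegative `u`. -/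
noncomputable def Q (φ : M.Stationary) (u : X → ℝ≥0∞) (x : X) : ℝ≥0∞ :=
  ∫⁻ y, u y ∂M.kernel (φ.pair x)

/-! ### The discounted cost criterion, for models whose kernel is a probability kernel -/

open Classical in
/-- The transition kernel, extended from `Gr` to all pairs.  The extension is
irrelevant, since under every policy all pairs are almost surely feasible. -/
noncomputable def extKernel : Kernel (X × A) X where
  toFun z := if h : z ∈ M.Gr then M.kernel ⟨z, h⟩ else Measure.dirac z.1
  measurable' := by
    classical
    exact Measurable.dite (s := M.Gr) (f := fun z => M.kernel z)
      (g := fun z => Measure.dirac z.1.1) M.kernel.measurable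
      (Measure.measurable_dirac.comp (measurable_fst.comp measurable_subtype_coe))
      M.measurableSet_gr

open Classical in
instance [IsMarkovKernel M.kernel] : IsMarkovKernel M.extKernel where
  isProbabilityMeasure z := by
    change IsProbabilityMeasure (if h : z ∈ M.Gr then M.kernel ⟨z, h⟩ else Measure.dirac z.1)
    split_ifs <;> infer_instance

open Classical in
/-- The one-step cost, extended by zero outside `Gr`. -/
noncomputable def extCost (z : X × A) : ℝ≥0 := if h : z ∈ M.Gr then M.cost ⟨z, h⟩ else 0

/-- The history formed by the pairs of the epochs `0, …, n` and the next state. -/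
def histSucc (n : ℕ) (p : (Finset.Iic n → X × A) × X) : Hist X A (n + 1) :=
  (fun i => p.1 ⟨i, Finset.mem_Iic.2 (Nat.lt_succ_iff.1 i.2)⟩, p.2)

lemma measurable_histSucc (n : ℕ) : Measurable (histSucc (X := X) (A := A) n) := by
  unfold histSucc
  fun_prop

variable {M}

/-- The conditional law of `(xₙ₊₁, aₙ₊₁)` given `(x₀, a₀), …, (xₙ, aₙ)` under the policy `π`:
first `xₙ₊₁` is drawn from `p(· | xₙ, aₙ)`, then `aₙ₊₁` from the decision rule of epoch `n + 1`. -/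
noncomputable def stepKernel (π : M.Policy) (n : ℕ) :
    Kernel (Finset.Iic n → X × A) (X × A) :=
  (M.extKernel.comap (fun h : Finset.Iic n → X × A => h ⟨n, Finset.mem_Iic.2 le_rfl⟩)
      (measurable_pi_apply _)) ⊗ₖ
    ((π.rule (n + 1)).comap (histSucc n) (measurable_histSucc n))

instance [IsMarkovKernel M.kernel] (π : M.Policy) (n : ℕ) : IsMarkovKernel (stepKernel π n) := by
  unfold stepKernel
  infer_instance

/-- The law of `(x₀, a₀)` when the initial state is `x`. -/
noncomputable def initLaw (π : M.Policy) (x : X) : Measure (X × A) :=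
  (π.rule 0 (Fin.elim0, x)).map (Prod.mk x)

/-- The law of the process `((xₙ, aₙ))ₙ` under the policy `π` with initial state `x`, given by the
Ionescu-Tulcea theorem. -/
noncomputable def pathLaw [IsMarkovKernel M.kernel] (π : M.Policy) (x : X) :
    Measure (ℕ → X × A) :=
  Kernel.trajMeasure (X := fun _ => X × A) (initLaw π x) (stepKernel π)

/-- The expected total discounted cost. -/
noncomputable def discountedCost [IsMarkovKernel M.kernel] (β : ℝ≥0) (π : M.Policy) (x : X) :
    ℝ≥0∞ :=
  ∫⁻ ω, ∑' n : ℕ, (β : ℝ≥0∞) ^ n * M.extCost (ω n) ∂pathLaw π x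

variable (M)

/-- The discounted value function: the infimum over all policies. -/
noncomputable def discountedValue [IsMarkovKernel M.kernel] (β : ℝ≥0) (x : X) : ℝ≥0∞ :=
  ⨅ π : M.Policy, discountedCost β π x

variable {M}

/-- `β`-optimality of a policy. -/
def IsDiscountOptimal [IsMarkovKernel M.kernel] (β : ℝ≥0) (π : M.Policy) : Prop :=
  ∀ x, discountedCost β π x = M.discountedValue β x

end General

/-! ### Continuity notions and assumptions -/

/-- Weak continuity of a kernel. -/
def WeaklyContinuous {S T : Type*} [TopologicalSpace S] [MeasurableSpace S] [TopologicalSpace T]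
    [MeasurableSpace T] (κ : Kernel S T) : Prop :=
  ∀ f : BoundedContinuousFunction T ℝ, Continuous fun s => ∫ t, f t ∂κ s

section Topological

variable {X A : Type*} [TopologicalSpace X] [MeasurableSpace X] [TopologicalSpace A]
  [MeasurableSpace A] (M : MDP X A)

/-- The set-valued map `x ↦ avail x` is compact-valued and continuous. -/
structure IsCompactContinuousAvail : Prop where
  isCompact : ∀ x, IsCompact (M.avail x)
  isOpen_upper : ∀ U : Set A, IsOpen U → IsOpen {x | M.avail x ⊆ U}
  isOpen_lower : ∀ U : Set A, IsOpen U → IsOpen {x | (M.avail x ∩ U).Nonempty}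

/-- `V` is a continuous function with values in `[1, ∞)`, and
`∑ₙ Q_φⁿ V (x) ≤ K V(x)` for all stationary policies `φ` and all states `x`. -/
structure IsTransientBound (V : X → ℝ≥0) (K : ℝ≥0) : Prop where
  continuous : Continuous V
  one_le : ∀ x, 1 ≤ V x
  tsum_le : ∀ (φ : M.Stationary) (x : X),
    ∑' n : ℕ, (M.Q φ)^[n] (fun y => (V y : ℝ≥0∞)) x ≤ K * V x

/-- `μ` is a weight function for the HV transformation: `V ≤ μ ≤ K V` and
`μ(x) ≥ V(x) + ∫ μ(y) q(dy | x, a)` for all feasible pairs `(x, a)`. -/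
structure IsHVWeight (V : X → ℝ≥0) (K : ℝ≥0) (μ : C(X, ℝ≥0)) : Prop where
  le_weight : ∀ x, V x ≤ μ x
  weight_le : ∀ x, μ x ≤ K * V x
  add_lintegral_le : ∀ z : M.Gr, (V z.1.1 : ℝ≥0∞) + ∫⁻ y, (μ y : ℝ≥0∞) ∂M.kernel z ≤ μ z.1.1

end Topological

/-! ### The Hoffman-Veinott transformation

The new state space is `X ⊕ Unit` (the added state is isolated from `X`) and the new action space
is `A ⊕ Unit`. -/

section HV

variable {X A : Type*} [MeasurableSpace X] [MeasurableSpace A] (M : MDP X A)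

/-- The available actions are unchanged on `X`, and only the added action is available in the
added state. -/
def hvAvail : X ⊕ Unit → Set (A ⊕ Unit) :=
  Sum.elim (fun x => Sum.inl '' M.avail x) (fun _ => {Sum.inr ()})

/-- The feasible pairs of the new model. -/
abbrev hvGr : Set ((X ⊕ Unit) × (A ⊕ Unit)) := {z | z.2 ∈ M.hvAvail z.1}

/-- A feasible pair of the new model is either a feasible pair of the original model or the added
pair. -/
def hvSplit : M.hvGr → M.Gr ⊕ Unit
  | ⟨(Sum.inl x, Sum.inl a), h⟩ =>
    Sum.inl ⟨(x, a), by simpa [hvAvail] using h⟩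
  | ⟨(Sum.inl _, Sum.inr _), h⟩ => False.elim (by simp [hvAvail] at h)
  | ⟨(Sum.inr _, _), _⟩ => Sum.inr ()

lemma measurableEmbedding_inl (S : Type*) [MeasurableSpace S] :
    MeasurableEmbedding (Sum.inl : S → S ⊕ Unit) where
  injective := Sum.inl_injective
  measurable := measurable_inl
  measurableSet_image' _ hs := hs.inl_image

lemma measurable_hvSplit : Measurable M.hvSplit := by
  intro s hs
  obtain ⟨hl, -⟩ := measurableSet_sum_iff.1 hs
  obtain ⟨t, ht, hts⟩ := hl
  have key : M.hvSplit ⁻¹' s = Subtype.val ⁻¹'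
      (Prod.map Sum.inl Sum.inl '' t ∪ {z : (X ⊕ Unit) × (A ⊕ Unit) |
        z.1 ∈ Set.range Sum.inr ∧ Sum.inr () ∈ s}) := by
    ext ⟨⟨x, a⟩, h⟩
    rcases x with x | x
    · rcases a with a | a
      · have hxa : (x, a) ∈ M.Gr := by simpa [hvAvail] using h
        have h1 := Set.ext_iff.1 hts ⟨(x, a), hxa⟩
        constructor
        · intro h2
          exact Or.inl ⟨(x, a), h1.2 h2, rfl⟩
        · rintro (⟨⟨x', a'⟩, h2, h3⟩ | ⟨⟨y, hy⟩, -⟩)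
          · simp only [Prod.map_apply, Prod.mk.injEq, Sum.inl.injEq] at h3
            obtain ⟨rfl, rfl⟩ := h3
            exact h1.1 h2
          · simp at hy
      · simp [hvAvail] at h
    · constructor
      · intro h2
        exact Or.inr ⟨⟨x, rfl⟩, h2⟩
      · rintro (⟨⟨y, b⟩, -, h3⟩ | ⟨-, h2⟩)
        · simp at h3
        · exact h2
  rw [key]
  refine measurable_subtype_coe (MeasurableSet.union ?_ ?_)
  · exact ((measurableEmbedding_inl X).prodMap (measurableEmbedding_inl A)).measurableSet_image' ht
  · exact (measurable_fst measurableSet_range_inr).inter (MeasurableSet.const _)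

lemma measurableSet_hvGr : MeasurableSet M.hvGr := by
  have key : M.hvGr = Prod.map Sum.inl Sum.inl '' M.Gr ∪
      {z | z.1 ∈ Set.range Sum.inr ∧ z.2 ∈ Set.range Sum.inr} := by
    ext ⟨x, a⟩
    rcases x with x | x <;> rcases a with a | a <;> simp [hvAvail]
  rw [key]
  refine MeasurableSet.union ?_ ?_
  · exact ((measurableEmbedding_inl X).prodMap (measurableEmbedding_inl A)).measurableSet_image'
      M.measurableSet_gr
  · exact (measurable_fst measurableSet_range_inr).inter (measurable_snd measurableSet_range_inr)

variable [TopologicalSpace X] [BorelSpace X]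

/-- The transition law of the new model at the feasible pairs of the original model: on `X` it is
`(β μ(x))⁻¹ μ(y) q(dy | x, a)`, and the remaining mass is at the added state. -/
noncomputable def hvLaw (μ : C(X, ℝ≥0)) (β : ℝ≥0) (z : M.Gr) : Measure (X ⊕ Unit) :=
  (β * μ z.1.1)⁻¹ • ((M.kernel z).withDensity fun y => (μ y : ℝ≥0∞)).map Sum.inl +
    (1 - ((β * μ z.1.1)⁻¹ : ℝ≥0) * ∫⁻ y, (μ y : ℝ≥0∞) ∂M.kernel z) • Measure.dirac (Sum.inr ())

lemma measurable_hvLaw (μ : C(X, ℝ≥0)) (β : ℝ≥0) : Measurable (M.hvLaw μ β) := by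
  have hμ : Measurable fun y => (μ y : ℝ≥0∞) := μ.continuous.measurable.coe_nnreal_ennreal
  have hw : Measurable fun z : M.Gr => ((β * μ z.1.1)⁻¹ : ℝ≥0) :=
    ((μ.continuous.measurable.comp (measurable_fst.comp measurable_subtype_coe)).const_mul β).inv
  refine Measure.measurable_of_measurable_coe _ fun s hs => ?_
  have : ∀ z : M.Gr, M.hvLaw μ β z s =
      (((β * μ z.1.1)⁻¹ : ℝ≥0) : ℝ≥0∞) * ∫⁻ y in Sum.inl ⁻¹' s, (μ y : ℝ≥0∞) ∂M.kernel z +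
      (1 - ((β * μ z.1.1)⁻¹ : ℝ≥0) * ∫⁻ y, (μ y : ℝ≥0∞) ∂M.kernel z) *
        Measure.dirac (Sum.inr ()) s := by
    intro z
    rw [hvLaw, Measure.add_apply, Measure.smul_apply, Measure.smul_apply,
      Measure.map_apply measurable_inl hs, withDensity_apply _ (measurable_inl hs)]
    rfl
  simp_rw [this]
  have h1 : Measurable fun z : M.Gr => ∫⁻ y in Sum.inl ⁻¹' s, (μ y : ℝ≥0∞) ∂M.kernel z := by
    simp_rw [← Kernel.lintegral_restrict M.kernel (measurable_inl hs)]
    exact hμ.lintegral_kernel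
  have h2 : Measurable fun z : M.Gr => ∫⁻ y, (μ y : ℝ≥0∞) ∂M.kernel z := hμ.lintegral_kernel
  exact (hw.coe_nnreal_ennreal.mul h1).add
    ((measurable_const.sub (hw.coe_nnreal_ennreal.mul h2)).mul_const _)

/-- The model obtained from `M` by the HV transformation with weight function `μ` and discount
factor `β`. -/
noncomputable def hv (μ : C(X, ℝ≥0)) (β : ℝ≥0) : MDP (X ⊕ Unit) (A ⊕ Unit) where
  avail := M.hvAvail
  measurableSet_gr := M.measurableSet_hvGr
  exists_selector := by
    obtain ⟨φ, hφ, h⟩ := M.exists_selector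
    refine ⟨Sum.map φ id, hφ.sumMap measurable_id, ?_⟩
    rintro (x | x)
    · simpa [hvAvail] using h x
    · simp [hvAvail]
  cost z := Sum.elim (fun z => (μ z.1.1)⁻¹ * M.cost z) (fun _ => 0) (M.hvSplit z)
  measurable_cost :=
    (((μ.continuous.measurable.comp (measurable_fst.comp measurable_subtype_coe)).inv.mul
      M.measurable_cost).sumElim measurable_const).comp M.measurable_hvSplit
  kernel :=
    { toFun := fun z =>
        Sum.elim (M.hvLaw μ β) (fun _ => Measure.dirac (Sum.inr ())) (M.hvSplit z)
      measurable' :=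
        ((M.measurable_hvLaw μ β).sumElim measurable_const).comp M.measurable_hvSplit }

/-- `c̃(z) + β ∫_X ṽ(y) p̃(dy | z)`, where `c̃`, `p̃` and `ṽ` are the one-step cost, the kernel and
the discounted value function of the model obtained from the HV transformation. -/
noncomputable def hvOneStep (μ : C(X, ℝ≥0)) (β : ℝ≥0) [IsMarkovKernel (M.hv μ β).kernel]
    (z : (M.hv μ β).Gr) : ℝ≥0∞ :=
  (M.hv μ β).cost z +
    β * ∫⁻ y in Set.range Sum.inl, (M.hv μ β).discountedValue β y ∂(M.hv μ β).kernel z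

end HV

end MDP

/-!
The proof has three parts.

*Weight functions.* For `r ∈ [0, 1]` let `w_r` be the maximal expected total reward, over Markov
policies, in the model with reward `V` and kernel `r • q`, obtained by iterating
`w ↦ V + r sup_a ∫ w dq` from zero (`totalWeight`). The transience bound concerns stationary
policies only, so that `w₁ ≤ K V` has to be proved, and the limit of the iterates has to be shown
continuous. Both follow by continuation in `r`. If `w_r` is continuous and `V`-bounded, then by
measurable selection `w_r = V + r Q_φ w_r` for a stationary policy `φ`, hence
`w_r ≤ ∑ₙ Q_φⁿ V ≤ K V` (`IsTransientBound.totalWeight_le`). Therefore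
`r sup_a ∫ w_r dq = w_r - V ≤ (1 - 1 / K) w_r`, so that for some `δ > 0` depending on `K` only the
operator with factor `r + δ` still is a contraction in the norm weighted by `w_r`; its iterates
converge uniformly in that norm, and `w_{r + δ}` is continuous and `V`-bounded
(`IsTransientBound.continuous_totalWeight_add`). Finitely many steps lead from `r = 0` to `r = 1`,
and `μ = w₁`.

*The transformed kernel.* `∫ μ dq ≤ μ - V ≤ β μ` bounds its mass on `X` by one. Its weak continuity
reduces to that of `∫ g μ dq` for bounded continuous `g ≥ 0`. As `g μ ≤ C V`, both `∫ g μ dq` and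
`∫ (C V - g μ) dq` are lower semicontinuous, while their sum is continuous
(`WeaklyContinuous.continuous_lintegral_of_le_of_continuous`).

*Dynamic programming.* In a model with lower semicontinuous costs, weakly continuous transition
probabilities and a compact-valued upper hemicontinuous action map, value iteration from zero
produces an increasing sequence of lower semicontinuous functions. Its limit solves the optimality
equation, since on compact sets the minimum commutes with increasing limits, and a stationary
policy attains the minimum by measurable selection. The cost of a stationary policy is the least
nonnegative solution of its evaluation equation, and every policy costs at least the `n`-th iterate,
by backward induction along the path measure (`le_sum_lintegral_extCost`); this identifies the limit
with the value function and gives the characterization of optimal stationary policies.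
-/

namespace MDP

open Set Filter Topology

/-! ### Measurable selection of minimizers -/

/-- A compact- and nonempty-valued map `C : X → Set A` whose lower inverse images
`{x | C x ∩ F ≠ ∅}` of closed sets `F` are measurable. -/
structure IsMeasurableCompactValued {X A : Type*} [MeasurableSpace X] [TopologicalSpace A]
    (C : X → Set A) : Prop where
  isCompact : ∀ x, IsCompact (C x)
  nonempty : ∀ x, (C x).Nonempty
  measurableSet : ∀ F : Set A, IsClosed F → MeasurableSet {x | (C x ∩ F).Nonempty}

/-- The minimizers of a continuous function `g` over the values of a measurable compact-valued map
again form such a map: a minimizer lies in `F` iff no rational number separates the minimum over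
`C x` from the minimum over `C x ∩ F`. -/
lemma IsMeasurableCompactValued.argmin {X A : Type*} [MeasurableSpace X] [TopologicalSpace A]
    {C : X → Set A} (hC : IsMeasurableCompactValued C) {g : A → ℝ} (hg : Continuous g) :
    IsMeasurableCompactValued fun x => {a ∈ C x | ∀ b ∈ C x, g a ≤ g b} where
  isCompact x := by
    have : {a ∈ C x | ∀ b ∈ C x, g a ≤ g b} = C x ∩ ⋂ b ∈ C x, {a | g a ≤ g b} := by
      ext a; simp
    rw [this]
    exact (hC.isCompact x).inter_right
      (isClosed_biInter fun b _ => isClosed_le hg continuous_const)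
  nonempty x := by
    obtain ⟨a, ha, hmin⟩ := (hC.isCompact x).exists_isMinOn (hC.nonempty x) hg.continuousOn
    exact ⟨a, ha, fun b hb => hmin hb⟩
  measurableSet F hF := by
    have key : {x | ({a ∈ C x | ∀ b ∈ C x, g a ≤ g b} ∩ F).Nonempty} =
        {x | (C x ∩ F).Nonempty} ∩ ⋂ q : ℚ, ({x | (C x ∩ {a | g a ≤ q}).Nonempty}ᶜ ∪
          {x | (C x ∩ (F ∩ {a | g a ≤ q})).Nonempty}) := by
      ext x
      simp only [mem_inter_iff, mem_iInter, mem_union, mem_compl_iff, mem_ofPred_eq]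
      constructor
      · rintro ⟨a, ⟨haC, hmin⟩, haF⟩
        refine ⟨⟨a, haC, haF⟩, fun q => or_iff_not_imp_left.2 fun h => ?_⟩
        obtain ⟨b, hbC, hbq⟩ := not_not.1 h
        exact ⟨a, haC, haF, (hmin b hbC).trans hbq⟩
      · rintro ⟨hne, hq⟩
        obtain ⟨a, ha, hmin⟩ := ((hC.isCompact x).inter_right hF).exists_isMinOn hne hg.continuousOn
        refine ⟨a, ⟨ha.1, fun b hb => ?_⟩, ha.2⟩
        by_contra! hlt
        obtain ⟨q, hbq, hqa⟩ := exists_rat_btwn hlt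
        rcases hq q with h | ⟨c, hcC, hcF, hcq⟩
        · exact h ⟨b, hb, hbq.le⟩
        · exact absurd ((hmin ⟨hcC, hcF⟩).trans hcq) (not_le.2 hqa)
    rw [key]
    refine (hC.measurableSet F hF).inter (MeasurableSet.iInter fun q => ?_)
    have hcl : IsClosed {a | g a ≤ (q : ℝ)} := isClosed_le hg continuous_const
    exact (hC.measurableSet _ hcl).compl.union (hC.measurableSet _ (hF.inter hcl))

/-- A measurable compact-valued map into a separable metrizable space has a Borel selector.
Minimizing successively the distances to the points of a dense sequence shrinks the values to
single points. -/
lemma IsMeasurableCompactValued.exists_measurable_selector {X A : Type*} [MeasurableSpace X]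
    [TopologicalSpace A] [TopologicalSpace.MetrizableSpace A] [SecondCountableTopology A]
    [MeasurableSpace A] [BorelSpace A] {C : X → Set A} (hC : IsMeasurableCompactValued C) :
    ∃ φ : X → A, Measurable φ ∧ ∀ x, φ x ∈ C x := by
  rcases isEmpty_or_nonempty X with hX | ⟨⟨x₀⟩⟩
  · exact ⟨fun x => isEmptyElim x, measurable_of_empty _, fun x => isEmptyElim x⟩
  have : Nonempty A := ⟨(hC.nonempty x₀).some⟩
  let _ := TopologicalSpace.metrizableSpaceMetric A
  let d := TopologicalSpace.denseSeq A
  let D : ℕ → X → Set A := fun k => Nat.rec C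
    (fun k E x => {a ∈ E x | ∀ b ∈ E x, dist a (d k) ≤ dist b (d k)}) k
  have hD : ∀ k, IsMeasurableCompactValued (D k) := by
    intro k
    induction k with
    | zero => exact hC
    | succ k ih => exact ih.argmin (continuous_id.dist continuous_const)
  have hsub : ∀ k x, D (k + 1) x ⊆ D k x := fun k x a ha => ha.1
  have hne : ∀ x, (⋂ k, D k x).Nonempty := fun x =>
    IsCompact.nonempty_iInter_of_sequence_nonempty_isCompact_isClosed _ (fun k => hsub k x)
      (fun k => (hD k).nonempty x) ((hD 0).isCompact x) fun k => ((hD k).isCompact x).isClosed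
  choose φ hφ using hne
  have huniq : ∀ x a, a ∈ ⋂ k, D k x → a = φ x := by
    intro x a ha
    have hdist : ∀ k, dist a (d k) = dist (φ x) (d k) := fun k =>
      le_antisymm ((mem_iInter.1 ha (k + 1)).2 _ (mem_iInter.1 (hφ x) k))
        ((mem_iInter.1 (hφ x) (k + 1)).2 _ (mem_iInter.1 ha k))
    have hclosed : IsClosed {b | dist a b = dist (φ x) b} :=
      isClosed_eq (continuous_const.dist continuous_id) (continuous_const.dist continuous_id)
    have := hclosed.closure_subset_iff.2 (range_subset_iff.2 hdist)
      ((TopologicalSpace.denseRange_denseSeq A).closure_range ▸ mem_univ a)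
    exact (dist_eq_zero.1 (by simpa using this.symm)).symm
  refine ⟨φ, measurable_of_isClosed fun F hF => ?_, fun x => mem_iInter.1 (hφ x) 0⟩
  have key : φ ⁻¹' F = ⋂ k, {x | (D k x ∩ F).Nonempty} := by
    ext x
    simp only [mem_preimage, mem_iInter, mem_ofPred_eq]
    refine ⟨fun h k => ⟨φ x, mem_iInter.1 (hφ x) k, h⟩, fun h => ?_⟩
    obtain ⟨a, ha⟩ := IsCompact.nonempty_iInter_of_sequence_nonempty_isCompact_isClosed
      (fun k => D k x ∩ F) (fun k => inter_subset_inter_left _ (hsub k x)) h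
      (((hD 0).isCompact x).inter_right hF) fun k => ((hD k).isCompact x).isClosed.inter hF
    rw [← iInter_inter] at ha
    exact huniq x a ha.1 ▸ ha.2
  rw [key]
  exact MeasurableSet.iInter fun k => (hD k).measurableSet F hF

/-! ### Optimization over the sets of available actions -/

lemma avail_nonempty {X A : Type*} [MeasurableSpace X] [MeasurableSpace A] (M : MDP X A) (x : X) :
    Nonempty (M.avail x) :=
  let ⟨φ, _, h⟩ := M.exists_selector
  ⟨φ x, h x⟩

section Berge

variable {X A : Type*} [TopologicalSpace X] [MeasurableSpace X] [TopologicalSpace A]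
  [MeasurableSpace A] {M : MDP X A}

lemma continuous_pair (M : MDP X A) (x : X) :
    Continuous fun a : M.avail x => M.pair x a a.2 :=
  Continuous.subtype_mk (by fun_prop) _

/-- The projection of the set of feasible pairs to the state space is a closed map. -/
lemma IsCompactContinuousAvail.isClosed_proj (h : M.IsCompactContinuousAvail) {S : Set M.Gr}
    (hS : IsClosed S) : IsClosed {x | ∃ a : M.avail x, M.pair x a a.2 ∈ S} := by
  obtain ⟨C, hC, rfl⟩ := isClosed_induced_iff.1 hS
  rw [← isOpen_compl_iff, isOpen_iff_mem_nhds]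
  intro x hx
  have hsub : ({x} : Set X) ×ˢ M.avail x ⊆ Cᶜ := by
    rintro ⟨y, a⟩ ⟨rfl, ha⟩ hmem
    exact hx ⟨⟨a, ha⟩, hmem⟩
  obtain ⟨U, W, hU, hW, hxU, hW', hUW⟩ :=
    generalized_tube_lemma isCompact_singleton (h.isCompact x) hC.isOpen_compl hsub
  filter_upwards [hU.mem_nhds (hxU rfl), (h.isOpen_upper W hW).mem_nhds hW'] with y hy hyW
  rintro ⟨a, ha⟩
  exact hUW (mk_mem_prod hy (hyW a.2)) ha

/-- The projection of the set of feasible pairs to the state space is an open map. -/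
lemma IsCompactContinuousAvail.isOpen_proj (h : M.IsCompactContinuousAvail) {S : Set M.Gr}
    (hS : IsOpen S) : IsOpen {x | ∃ a : M.avail x, M.pair x a a.2 ∈ S} := by
  obtain ⟨O, hO, rfl⟩ := isOpen_induced_iff.1 hS
  rw [isOpen_iff_mem_nhds]
  rintro x ⟨a, ha⟩
  obtain ⟨U, W, hU, hW, hxU, haW, hUW⟩ := isOpen_prod_iff.1 hO x a ha
  filter_upwards [hU.mem_nhds hxU, (h.isOpen_lower W hW).mem_nhds ⟨a, a.2, haW⟩] with y hy hyW
  obtain ⟨b, hb, hbW⟩ := hyW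
  exact ⟨⟨b, hb⟩, hUW (mk_mem_prod hy hbW)⟩

lemma IsCompactContinuousAvail.exists_eq_iInf (h : M.IsCompactContinuousAvail) {f : M.Gr → ℝ≥0∞}
    (hf : LowerSemicontinuous f) (x : X) :
    ∃ a : M.avail x, f (M.pair x a a.2) = ⨅ b : M.avail x, f (M.pair x b b.2) := by
  have := isCompact_iff_compactSpace.1 (h.isCompact x)
  have := M.avail_nonempty x
  obtain ⟨a, -, ha⟩ := ((hf.comp (M.continuous_pair x)).lowerSemicontinuousOn
    univ).exists_isMinOn univ_nonempty isCompact_univ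
  exact ⟨a, le_antisymm (le_iInf fun b => ha (mem_univ b)) (iInf_le _ a)⟩

/-- The half of Berge's theorem that concerns minimization of a lower semicontinuous function. -/
lemma IsCompactContinuousAvail.lowerSemicontinuous_iInf (h : M.IsCompactContinuousAvail)
    {f : M.Gr → ℝ≥0∞} (hf : LowerSemicontinuous f) :
    LowerSemicontinuous fun x => ⨅ a : M.avail x, f (M.pair x a a.2) := by
  rw [lowerSemicontinuous_iff_isClosed_preimage]
  intro t
  convert h.isClosed_proj (hf.isClosed_preimage t) using 1
  ext x
  constructor
  · intro hx
    obtain ⟨a, ha⟩ := h.exists_eq_iInf hf x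
    exact ⟨a, ha.trans_le hx⟩
  · rintro ⟨a, ha⟩
    exact mem_preimage.2 (mem_Iic.2 (iInf_le_of_le a (mem_Iic.1 (mem_preimage.1 ha))))

/-- A lower semicontinuous function on the set of feasible pairs is minimized by a stationary
policy. -/
lemma IsCompactContinuousAvail.exists_stationary_eq_iInf [BorelSpace X]
    [TopologicalSpace.MetrizableSpace A] [SecondCountableTopology A] [BorelSpace A]
    (h : M.IsCompactContinuousAvail) {f : M.Gr → ℝ≥0∞} (hf : LowerSemicontinuous f) :
    ∃ φ : M.Stationary, ∀ x, f (φ.pair x) = ⨅ a : M.avail x, f (M.pair x a a.2) := by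
  let m : X → ℝ≥0∞ := fun x => ⨅ a : M.avail x, f (M.pair x a a.2)
  have hC : IsMeasurableCompactValued fun x =>
      Subtype.val '' {a : M.avail x | f (M.pair x a a.2) ≤ m x} := by
    refine ⟨fun x => ?_, fun x => ?_, fun F hF => ?_⟩
    · have := isCompact_iff_compactSpace.1 (h.isCompact x)
      exact ((hf.comp (M.continuous_pair x)).isClosed_preimage (m x)).isCompact.image
        continuous_subtype_val
    · obtain ⟨a, ha⟩ := h.exists_eq_iInf hf x
      exact ⟨a, a, ha.le, rfl⟩
    · -- Adding `⊤` off `F` keeps the function lower semicontinuous and restricts the minimization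
      -- to `F`.
      let e : M.Gr → ℝ≥0∞ := {z : M.Gr | z.1.2 ∉ F}.indicator fun _ => ⊤
      have hopen : IsOpen {z : M.Gr | z.1.2 ∉ F} :=
        hF.isOpen_compl.preimage (continuous_snd.comp continuous_subtype_val)
      have hfe : LowerSemicontinuous fun z => f z + e z :=
        hf.add (hopen.lowerSemicontinuous_indicator zero_le)
      have hFx : IsClosed {x | ∃ a : M.avail x, M.pair x a a.2 ∈ {z : M.Gr | z.1.2 ∈ F}} :=
        h.isClosed_proj (hF.preimage (continuous_snd.comp continuous_subtype_val))
      have key : {x | (Subtype.val '' {a : M.avail x | f (M.pair x a a.2) ≤ m x} ∩ F).Nonempty} =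
          {x | ∃ a : M.avail x, M.pair x a a.2 ∈ {z : M.Gr | z.1.2 ∈ F}} ∩
            {x | ⨅ a : M.avail x, (f (M.pair x a a.2) + e (M.pair x a a.2)) ≤ m x} := by
        ext x
        constructor
        · rintro ⟨_, ⟨a, ha, rfl⟩, haF⟩
          refine ⟨⟨a, haF⟩, mem_ofPred_eq.mpr (iInf_le_of_le a ?_)⟩
          have : e (M.pair x a a.2) = 0 := indicator_of_notMem (by simpa using haF) _
          rw [this, add_zero]
          exact ha
        · rintro ⟨⟨a, haF⟩, hx⟩
          by_cases hm : m x = ⊤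
          · exact ⟨a, ⟨a, by simp [hm], rfl⟩, haF⟩
          obtain ⟨b, hb⟩ := h.exists_eq_iInf hfe x
          have hb' := hb.trans_le hx
          have hbF : (b : A) ∈ F := by
            by_contra hbF
            have : e (M.pair x b b.2) = ⊤ := indicator_of_mem (by simpa using hbF) _
            rw [this, add_top] at hb'
            exact hm (top_le_iff.1 hb')
          exact ⟨b, ⟨b, le_self_add.trans hb', rfl⟩, hbF⟩
      rw [key]
      exact hFx.measurableSet.inter (measurableSet_le (h.lowerSemicontinuous_iInf hfe).measurable
        (h.lowerSemicontinuous_iInf hf).measurable)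
  obtain ⟨φ, hφ, hmem⟩ := hC.exists_measurable_selector
  have hmem' : ∀ x, ∃ ha : φ x ∈ M.avail x, f (M.pair x (φ x) ha) ≤ m x := by
    intro x
    obtain ⟨a, ha, hax⟩ := hmem x
    rw [← hax]
    exact ⟨a.2, ha⟩
  exact ⟨⟨φ, hφ, fun x => (hmem' x).1⟩, fun x => le_antisymm (hmem' x).2
    (iInf_le _ (⟨φ x, (hmem' x).1⟩ : M.avail x))⟩

/-- A continuous function on the set of feasible pairs is maximized by a stationary policy. -/
lemma IsCompactContinuousAvail.exists_stationary_eq_iSup [BorelSpace X]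
    [TopologicalSpace.MetrizableSpace A] [SecondCountableTopology A] [BorelSpace A]
    (h : M.IsCompactContinuousAvail) {f : M.Gr → ℝ≥0∞} (hf : Continuous f) :
    ∃ φ : M.Stationary, ∀ x, f (φ.pair x) = ⨆ a : M.avail x, f (M.pair x a a.2) := by
  obtain ⟨φ, hφ⟩ := h.exists_stationary_eq_iInf (f := fun z => (f z)⁻¹) hf.inv.lowerSemicontinuous
  refine ⟨φ, fun x => inv_injective ?_⟩
  rw [ENNReal.inv_iSup, hφ x]

/-- Berge's maximum theorem. -/
lemma IsCompactContinuousAvail.continuous_iSup (h : M.IsCompactContinuousAvail)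
    {f : M.Gr → ℝ≥0∞} (hf : Continuous f) :
    Continuous fun x => ⨆ a : M.avail x, f (M.pair x a a.2) := by
  rw [continuous_iff_lower_upperSemicontinuous]
  constructor
  · rw [lowerSemicontinuous_iff_isOpen_preimage]
    intro t
    convert h.isOpen_proj (isOpen_lt continuous_const hf : IsOpen {z | t < f z}) using 1
    ext x
    simp [lt_iSup_iff]
  · have := continuous_inv.comp_lowerSemicontinuous_antitone
      (h.lowerSemicontinuous_iInf (f := fun z => (f z)⁻¹) hf.inv.lowerSemicontinuous)
      (fun a b hab => ENNReal.inv_le_inv.2 hab)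
    simpa [Function.comp_def, ENNReal.inv_iInf] using this

/-- On compact action sets, minimization commutes with the supremum of an increasing sequence of
lower semicontinuous functions. -/
lemma IsCompactContinuousAvail.iInf_iSup_eq [T2Space A] (h : M.IsCompactContinuousAvail)
    {f : ℕ → M.Gr → ℝ≥0∞}
    (hf : ∀ n, LowerSemicontinuous (f n)) (hmono : Monotone f) (x : X) :
    ⨅ a : M.avail x, ⨆ n, f n (M.pair x a a.2) = ⨆ n, ⨅ a : M.avail x, f n (M.pair x a a.2) := by
  refine le_antisymm ?_ (iSup_iInf_le_iInf_iSup _)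
  set t := ⨆ n, ⨅ a : M.avail x, f n (M.pair x a a.2) with ht
  have := isCompact_iff_compactSpace.1 (h.isCompact x)
  have hcl : ∀ n, IsClosed {a : M.avail x | f n (M.pair x a a.2) ≤ t} := fun n =>
    ((hf n).comp (M.continuous_pair x)).isClosed_preimage t
  obtain ⟨a, ha⟩ := IsCompact.nonempty_iInter_of_sequence_nonempty_isCompact_isClosed
    (fun n => {a : M.avail x | f n (M.pair x a a.2) ≤ t})
    (fun n a ha => (hmono n.le_succ _).trans ha)
    (fun n => by
      obtain ⟨a, ha⟩ := h.exists_eq_iInf (hf n) x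
      exact ⟨a, ha.trans_le (le_iSup (fun n => ⨅ a : M.avail x, f n (M.pair x a a.2)) n)⟩)
    (hcl 0).isCompact hcl
  exact (iInf_le _ a).trans (iSup_le fun n => mem_iInter.1 ha n)

end Berge

/-! ### Integrals against weakly continuous kernels -/

section Weak

variable {S T : Type*} [TopologicalSpace S] [MeasurableSpace S] [TopologicalSpace T]
  [MeasurableSpace T] [BorelSpace T] {κ : Kernel S T} [IsFiniteKernel κ]

lemma WeaklyContinuous.continuous_lintegral_of_le (hκ : WeaklyContinuous κ) {g : T → ℝ≥0∞}
    (hg : Continuous g) {C : ℝ≥0} (hC : ∀ t, g t ≤ C) : Continuous fun s => ∫⁻ t, g t ∂κ s := by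
  have hfin : ∀ t, g t ≠ ⊤ := fun t => ne_top_of_le_ne_top ENNReal.coe_ne_top (hC t)
  let f : BoundedContinuousFunction T ℝ := BoundedContinuousFunction.ofNormedAddCommGroup
    (fun t => (g t).toReal) (ENNReal.continuousOn_toReal.comp_continuous hg hfin) C fun t => by
      rw [Real.norm_of_nonneg ENNReal.toReal_nonneg]
      exact ENNReal.toReal_mono ENNReal.coe_ne_top (hC t)
  have : ∀ s, ∫⁻ t, g t ∂κ s = ENNReal.ofReal (∫ t, f t ∂κ s) := by
    intro s
    rw [ofReal_integral_eq_lintegral_ofReal (f.integrable _)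
      (Eventually.of_forall fun t => ENNReal.toReal_nonneg)]
    exact lintegral_congr fun t => (ENNReal.ofReal_toReal (hfin t)).symm
  simp_rw [this]
  exact ENNReal.continuous_ofReal.comp (hκ f)

/-- Lower semicontinuity of integrals: a nonnegative lower semicontinuous function is the
increasing limit of its Lipschitz regularizations, which are bounded and continuous. -/
lemma WeaklyContinuous.lowerSemicontinuous_lintegral [TopologicalSpace.MetrizableSpace T]
    (hκ : WeaklyContinuous κ) {g : T → ℝ≥0∞} (hg : LowerSemicontinuous g) :
    LowerSemicontinuous fun s => ∫⁻ t, g t ∂κ s := by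
  let _ := TopologicalSpace.metrizableSpaceMetric T
  let H : ℕ → T → ℝ≥0∞ := fun n x => ⨅ y, (min (g y) n + n * edist x y)
  have hle : ∀ n x, H n x ≤ min (g x) n := fun n x => (iInf_le _ x).trans (by simp)
  have hcont : ∀ n, Continuous (H n) := by
    intro n
    refine continuous_of_le_add_edist n (ENNReal.natCast_ne_top n) fun x y => ?_
    simp only [H]
    rw [ENNReal.iInf_add]
    refine le_iInf fun z => (iInf_le _ z).trans ?_
    rw [add_assoc, ← mul_add]
    gcongr
    rw [add_comm]
    exact edist_triangle x y z
  have hmono : Monotone H := by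
    intro n m hnm x
    refine iInf_mono fun y => ?_
    gcongr
  have hsup : ∀ x, g x = ⨆ n, H n x := by
    intro x
    refine le_antisymm (le_of_forall_lt fun t ht => ?_)
      (iSup_le fun n => (hle n x).trans (min_le_left _ _))
    obtain ⟨t', htt', ht'⟩ := exists_between ht
    obtain ⟨ε, hε, hball⟩ := EMetric.mem_nhds_iff.1 (hg x t' ht')
    have ht'top : t' ≠ ⊤ := ne_top_of_lt ht'
    obtain ⟨n₁, hn₁⟩ := ENNReal.exists_nat_gt ht'top
    obtain ⟨n₂, hn₂⟩ := ENNReal.exists_nat_mul_gt hε.ne' ht'top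
    refine htt'.trans_le (le_trans ?_ (le_iSup (fun n => H n x) (max n₁ n₂)))
    refine le_iInf fun y => ?_
    by_cases hy : edist y x < ε
    · refine le_trans (le_min (hball hy).le ?_) le_self_add
      exact hn₁.le.trans (by exact_mod_cast le_max_left _ _)
    · refine le_trans (hn₂.le.trans ?_) le_add_self
      rw [edist_comm x y]
      gcongr
      · exact le_max_right _ _
      · exact not_lt.1 hy
  have hint : ∀ s, ∫⁻ t, g t ∂κ s = ⨆ n, ∫⁻ t, H n t ∂κ s := by
    intro s
    simp_rw [hsup]
    exact lintegral_iSup (fun n => (hcont n).measurable) hmono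
  simp_rw [hint]
  exact lowerSemicontinuous_iSup fun n => (hκ.continuous_lintegral_of_le (hcont n) (C := n)
    fun t => (hle n t).trans ((min_le_right _ _).trans (by simp))).lowerSemicontinuous

/-- Continuity of integrals of functions dominated by a function with a continuous integral: both
`∫ g` and `∫ (V - g)` are lower semicontinuous and their sum is continuous. -/
lemma WeaklyContinuous.continuous_lintegral_of_le_of_continuous
    [TopologicalSpace.MetrizableSpace T] (hκ : WeaklyContinuous κ) {g V : T → ℝ≥0∞}
    (hg : Continuous g) (hV : Continuous V) (hVtop : ∀ t, V t ≠ ⊤) (hgV : ∀ t, g t ≤ V t)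
    (hint : Continuous fun s => ∫⁻ t, V t ∂κ s) (hfin : ∀ s, ∫⁻ t, V t ∂κ s ≠ ⊤) :
    Continuous fun s => ∫⁻ t, g t ∂κ s := by
  have hsub : Continuous fun t => V t - g t := by
    rw [continuous_iff_continuousAt]
    exact fun t => ENNReal.Tendsto.sub hV.continuousAt hg.continuousAt (Or.inl (hVtop t))
  have hlsc := hκ.lowerSemicontinuous_lintegral hg.lowerSemicontinuous
  have hlsc' := hκ.lowerSemicontinuous_lintegral hsub.lowerSemicontinuous
  have hadd : ∀ s, ∫⁻ t, g t ∂κ s + ∫⁻ t, (V t - g t) ∂κ s = ∫⁻ t, V t ∂κ s := by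
    intro s
    rw [← lintegral_add_left hg.measurable]
    exact lintegral_congr fun t => add_tsub_cancel_of_le (hgV t)
  have hfin' : ∀ s, ∫⁻ t, (V t - g t) ∂κ s ≠ ⊤ := fun s =>
    ne_top_of_le_ne_top (hfin s) (lintegral_mono fun t => tsub_le_self)
  rw [continuous_iff_lower_upperSemicontinuous]
  refine ⟨hlsc, fun s t hst => ?_⟩
  have h1 : ∫⁻ t, V t ∂κ s < t + ∫⁻ t, (V t - g t) ∂κ s := by
    rw [← hadd s]
    exact ENNReal.add_lt_add_right (hfin' s) hst
  have h2 : LowerSemicontinuous fun s => t + ∫⁻ t, (V t - g t) ∂κ s :=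
    lowerSemicontinuous_const.add hlsc'
  obtain ⟨r, hr, hr'⟩ := exists_between h1
  filter_upwards [hint.tendsto s (Iio_mem_nhds hr), h2 s r hr'] with s' h3 h4
  have h5 : ∫⁻ t, g t ∂κ s' + ∫⁻ t, (V t - g t) ∂κ s' < t + ∫⁻ t, (V t - g t) ∂κ s' := by
    rw [hadd s']
    exact lt_trans h3 h4
  exact lt_of_add_lt_add_right h5

end Weak

/-! ### Existence of weight functions -/

section MaxIntegral

variable {X A : Type*} [MeasurableSpace X] [MeasurableSpace A] (M : MDP X A)

/-- The maximal one-step integral `sup_{a ∈ A(x)} ∫ w(y) q(dy | x, a)`. -/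
noncomputable def maxIntegral (w : X → ℝ≥0∞) (x : X) : ℝ≥0∞ :=
  ⨆ a : M.avail x, ∫⁻ y, w y ∂M.kernel (M.pair x a a.2)

/-- The iterates, starting from zero, of `w ↦ V + r * maxIntegral w`. -/
noncomputable def weightIter (V : X → ℝ≥0) (r : ℝ≥0) : ℕ → X → ℝ≥0∞
  | 0, _ => 0
  | n + 1, x => V x + r * M.maxIntegral (weightIter V r n) x

/-- The limit of `weightIter`: the maximal expected total reward in the model with one-step reward
`V` and kernel `r • q`. -/
noncomputable def totalWeight (V : X → ℝ≥0) (r : ℝ≥0) (x : X) : ℝ≥0∞ :=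
  ⨆ n, M.weightIter V r n x

variable {M}

lemma maxIntegral_mono : Monotone M.maxIntegral := fun _ _ h _ =>
  iSup_mono fun _ => lintegral_mono fun y => h y

lemma lintegral_le_maxIntegral (w : X → ℝ≥0∞) (z : M.Gr) :
    ∫⁻ y, w y ∂M.kernel z ≤ M.maxIntegral w z.1.1 :=
  le_iSup (fun a : M.avail z.1.1 => ∫⁻ y, w y ∂M.kernel (M.pair z.1.1 a a.2)) ⟨z.1.2, z.2⟩

lemma maxIntegral_const_mul_le (c : ℝ≥0) (w : X → ℝ≥0∞) (x : X) :
    M.maxIntegral (fun y => c * w y) x ≤ c * M.maxIntegral w x := by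
  refine iSup_le fun a => ?_
  rw [lintegral_const_mul' _ _ ENNReal.coe_ne_top]
  gcongr
  exact lintegral_le_maxIntegral w (M.pair x a a.2)

lemma maxIntegral_add_const_mul_le {u : X → ℝ≥0∞} (hu : Measurable u) (c : ℝ≥0) (w : X → ℝ≥0∞)
    (x : X) :
    M.maxIntegral (fun y => u y + c * w y) x ≤ M.maxIntegral u x + c * M.maxIntegral w x := by
  refine iSup_le fun a => ?_
  rw [lintegral_add_left hu, lintegral_const_mul' _ _ ENNReal.coe_ne_top]
  gcongr
  · exact lintegral_le_maxIntegral u (M.pair x a a.2)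
  · exact lintegral_le_maxIntegral w (M.pair x a a.2)

lemma weightIter_mono (V : X → ℝ≥0) (r : ℝ≥0) : Monotone (M.weightIter V r) := by
  refine monotone_nat_of_le_succ fun n => ?_
  induction n with
  | zero => exact fun x => zero_le
  | succ n ih =>
    intro x
    simp only [weightIter]
    gcongr
    exact maxIntegral_mono ih x

lemma le_totalWeight (V : X → ℝ≥0) (r : ℝ≥0) (x : X) : V x ≤ M.totalWeight V r x :=
  le_self_add.trans (le_iSup (fun n => M.weightIter V r n x) 1)

lemma totalWeight_eq {V : X → ℝ≥0} {r : ℝ≥0} (h : ∀ n, Measurable (M.weightIter V r n)) (x : X) :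
    M.totalWeight V r x = V x + r * M.maxIntegral (M.totalWeight V r) x := by
  have h1 : M.maxIntegral (M.totalWeight V r) x = ⨆ n, M.maxIntegral (M.weightIter V r n) x := by
    simp only [maxIntegral, totalWeight]
    rw [iSup_comm]
    refine iSup_congr fun a => ?_
    exact lintegral_iSup h (weightIter_mono V r)
  have h2 : M.totalWeight V r x = ⨆ n, M.weightIter V r (n + 1) x :=
    ((weightIter_mono V r).apply₂ x).iSup_nat_add 1 |>.symm
  rw [h1, h2, ENNReal.mul_iSup, ENNReal.add_iSup]
  rfl

lemma measurable_stationary_pair (φ : M.Stationary) : Measurable φ.pair :=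
  (measurable_id.prodMk φ.measurable_act).subtype_mk

lemma measurable_Q (φ : M.Stationary) {u : X → ℝ≥0∞} (hu : Measurable u) :
    Measurable (M.Q φ u) :=
  hu.lintegral_kernel.comp (measurable_stationary_pair φ)

lemma measurable_Q_iterate (φ : M.Stationary) {u : X → ℝ≥0∞} (hu : Measurable u) (n : ℕ) :
    Measurable ((M.Q φ)^[n] u) := by
  induction n with
  | zero => exact hu
  | succ n ih =>
    rw [Function.iterate_succ_apply']
    exact measurable_Q φ ih

/-- A `V`-bounded subsolution of `w = V + Q_φ w` is at most `∑ₙ Q_φⁿ V`. -/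
lemma le_tsum_Q_iterate {φ : M.Stationary} {v w : X → ℝ≥0∞} (hv : Measurable v)
    {C : ℝ≥0} (hC : ∀ x, w x ≤ C * v x) (hw : ∀ x, w x ≤ v x + M.Q φ w x) {x : X}
    (hx : ∑' n, (M.Q φ)^[n] v x ≠ ⊤) : w x ≤ ∑' n, (M.Q φ)^[n] v x := by
  have hm := measurable_Q_iterate φ hv
  have key : ∀ n x, w x ≤ ∑ k ∈ Finset.range n, (M.Q φ)^[k] v x + C * (M.Q φ)^[n] v x := by
    intro n
    induction n with
    | zero => simpa using hC
    | succ n ih =>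
      intro x
      have h1 : M.Q φ w x ≤ ∑ k ∈ Finset.range n, (M.Q φ)^[k + 1] v x +
          C * (M.Q φ)^[n + 1] v x := by
        refine (lintegral_mono ih).trans_eq ?_
        rw [lintegral_add_left (Finset.measurable_fun_sum _ fun k _ => hm k),
          lintegral_finsetSum _ fun k _ => hm k, lintegral_const_mul _ (hm n)]
        simp_rw [Function.iterate_succ_apply']
        rfl
      calc w x ≤ v x + M.Q φ w x := hw x
        _ ≤ v x + (∑ k ∈ Finset.range n, (M.Q φ)^[k + 1] v x + C * (M.Q φ)^[n + 1] v x) := by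
          gcongr
        _ = _ := by
          rw [Finset.sum_range_succ', ← add_assoc, add_comm (v x)]
          rfl
  have hlim : Tendsto (fun n => ∑' n, (M.Q φ)^[n] v x + C * (M.Q φ)^[n] v x) atTop
      (𝓝 (∑' n, (M.Q φ)^[n] v x + C * 0)) :=
    tendsto_const_nhds.add (ENNReal.Tendsto.const_mul
      (ENNReal.tendsto_atTop_zero_of_tsum_ne_top hx) (Or.inr ENNReal.coe_ne_top))
  rw [mul_zero, add_zero] at hlim
  exact ge_of_tendsto' hlim fun n => (key n x).trans (by gcongr; exact ENNReal.sum_le_tsum _)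

end MaxIntegral

section Weight

variable {X A : Type*}
    [TopologicalSpace X] [MeasurableSpace X] [BorelSpace X]
    [TopologicalSpace A] [TopologicalSpace.MetrizableSpace A] [SecondCountableTopology A]
    [MeasurableSpace A] [BorelSpace A]
    {M : MDP X A} {V : X → ℝ≥0} {K : ℝ≥0}

lemma IsTransientBound.maxIntegral_le (hT : M.IsTransientBound V K)
    (hWi : M.IsCompactContinuousAvail)
    (hV : Continuous fun z : M.Gr => ∫⁻ y, (V y : ℝ≥0∞) ∂M.kernel z) (x : X) :
    M.maxIntegral (fun y => V y) x ≤ K * V x := by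
  obtain ⟨φ, hφ⟩ := hWi.exists_stationary_eq_iSup hV
  exact (hφ x).ge.trans ((ENNReal.le_tsum 1).trans (hT.tsum_le φ x))

lemma IsTransientBound.lintegral_ne_top (hT : M.IsTransientBound V K)
    (hWi : M.IsCompactContinuousAvail)
    (hV : Continuous fun z : M.Gr => ∫⁻ y, (V y : ℝ≥0∞) ∂M.kernel z) (z : M.Gr) :
    ∫⁻ y, (V y : ℝ≥0∞) ∂M.kernel z ≠ ⊤ :=
  ne_top_of_le_ne_top (ENNReal.mul_ne_top ENNReal.coe_ne_top ENNReal.coe_ne_top)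
    ((lintegral_le_maxIntegral _ z).trans (hT.maxIntegral_le hWi hV z.1.1))

variable [TopologicalSpace.MetrizableSpace X] [IsFiniteKernel M.kernel]

lemma IsTransientBound.continuous_lintegral (hT : M.IsTransientBound V K)
    (hWi : M.IsCompactContinuousAvail) (hWii : WeaklyContinuous M.kernel)
    (hV : Continuous fun z : M.Gr => ∫⁻ y, (V y : ℝ≥0∞) ∂M.kernel z) {w : X → ℝ≥0∞}
    (hw : Continuous w) {C : ℝ≥0} (hC : ∀ x, w x ≤ C * V x) :
    Continuous fun z : M.Gr => ∫⁻ y, w y ∂M.kernel z := by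
  have hVc : Continuous fun y => (V y : ℝ≥0∞) := ENNReal.continuous_coe.comp hT.continuous
  have heq : ∀ z : M.Gr, ∫⁻ y, C * (V y : ℝ≥0∞) ∂M.kernel z =
      C * ∫⁻ y, (V y : ℝ≥0∞) ∂M.kernel z := fun z =>
    lintegral_const_mul' _ _ ENNReal.coe_ne_top
  refine hWii.continuous_lintegral_of_le_of_continuous (V := fun y => C * (V y : ℝ≥0∞)) hw
    ((ENNReal.continuous_const_mul ENNReal.coe_ne_top).comp hVc)
    (fun t => ENNReal.mul_ne_top ENNReal.coe_ne_top ENNReal.coe_ne_top) hC ?_ ?_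
  · simp_rw [heq]
    exact (ENNReal.continuous_const_mul ENNReal.coe_ne_top).comp hV
  · intro z
    rw [heq]
    exact ENNReal.mul_ne_top ENNReal.coe_ne_top (hT.lintegral_ne_top hWi hV z)

lemma IsTransientBound.continuous_weightIter (hT : M.IsTransientBound V K)
    (hWi : M.IsCompactContinuousAvail) (hWii : WeaklyContinuous M.kernel)
    (hV : Continuous fun z : M.Gr => ∫⁻ y, (V y : ℝ≥0∞) ∂M.kernel z) {r C : ℝ≥0}
    (hC : ∀ n x, M.weightIter V r n x ≤ C * V x) (n : ℕ) : Continuous (M.weightIter V r n) := by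
  induction n with
  | zero => exact continuous_const
  | succ n ih =>
    exact (ENNReal.continuous_coe.comp hT.continuous).add
      ((ENNReal.continuous_const_mul ENNReal.coe_ne_top).comp
        (hWi.continuous_iSup (hT.continuous_lintegral hWi hWii hV ih (hC n))))

/-- If the maximal total reward of the model with kernel `r • q`, `r ≤ 1`, is continuous and
`V`-bounded, then it is at most `K V`: it is attained by a stationary policy. -/
lemma IsTransientBound.totalWeight_le (hT : M.IsTransientBound V K)
    (hWi : M.IsCompactContinuousAvail) (hWii : WeaklyContinuous M.kernel)
    (hV : Continuous fun z : M.Gr => ∫⁻ y, (V y : ℝ≥0∞) ∂M.kernel z) {r C : ℝ≥0} (hr : r ≤ 1)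
    (hcont : Continuous (M.totalWeight V r)) (hC : ∀ x, M.totalWeight V r x ≤ C * V x) (x : X) :
    M.totalWeight V r x ≤ K * V x := by
  have hiter := hT.continuous_weightIter hWi hWii hV (r := r) (C := C)
    fun n x => (le_iSup (fun n => M.weightIter V r n x) n).trans (hC x)
  have hfix := totalWeight_eq fun n => (hiter n).measurable
  obtain ⟨φ, hφ⟩ := hWi.exists_stationary_eq_iSup (hT.continuous_lintegral hWi hWii hV hcont hC)
  refine (le_tsum_Q_iterate (φ := φ) (v := fun y => (V y : ℝ≥0∞))
    hT.continuous.measurable.coe_nnreal_ennreal hC (fun y => ?_)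
    (ne_top_of_le_ne_top ?_ (hT.tsum_le φ x))).trans (hT.tsum_le φ x)
  · rw [hfix y]
    gcongr
    refine (mul_le_of_le_one_left zero_le (by exact_mod_cast hr)).trans ?_
    exact (hφ y).ge
  · exact ENNReal.mul_ne_top ENNReal.coe_ne_top ENNReal.coe_ne_top

/-- If `w ↦ r * maxIntegral w` is a contraction in the weighted norm given by some continuous `w`
comparable with `V`, then `weightIter` converges uniformly in that norm, so that its limit is
continuous. -/
lemma IsTransientBound.continuous_totalWeight_of_contraction (hT : M.IsTransientBound V K)
    (hWi : M.IsCompactContinuousAvail) (hWii : WeaklyContinuous M.kernel)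
    (hV : Continuous fun z : M.Gr => ∫⁻ y, (V y : ℝ≥0∞) ∂M.kernel z) {r C ρ : ℝ≥0} (hρ : ρ < 1)
    {w : X → ℝ≥0∞} (hw : Continuous w) (hVw : ∀ x, V x ≤ w x) (hwV : ∀ x, w x ≤ C * V x)
    (hcontr : ∀ x, r * M.maxIntegral w x ≤ ρ * w x) :
    Continuous (M.totalWeight V r) ∧ ∃ C' : ℝ≥0, ∀ x, M.totalWeight V r x ≤ C' * V x := by
  have hwtop : ∀ x, w x ≠ ⊤ := fun x => ne_top_of_le_ne_top
    (ENNReal.mul_ne_top ENNReal.coe_ne_top ENNReal.coe_ne_top) (hwV x)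
  -- `B = 1 + ρ + ρ² + ⋯`
  obtain ⟨B, hB⟩ : ∃ B : ℝ≥0, 1 + ρ * B = B := by
    refine ⟨(1 - ρ)⁻¹, ?_⟩
    have h1 : 1 - ρ ≠ 0 := (tsub_pos_of_lt hρ).ne'
    calc 1 + ρ * (1 - ρ)⁻¹ = ((1 - ρ) + ρ) * (1 - ρ)⁻¹ := by rw [add_mul, mul_inv_cancel₀ h1]
      _ = _ := by rw [tsub_add_cancel_of_le hρ.le, one_mul]
  have hBw : ∀ n x, M.weightIter V r n x ≤ B * w x := by
    intro n
    induction n with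
    | zero => exact fun x => zero_le
    | succ n ih =>
      intro x
      calc M.weightIter V r (n + 1) x = V x + r * M.maxIntegral (M.weightIter V r n) x := rfl
        _ ≤ w x + r * (B * M.maxIntegral w x) := by
          gcongr
          · exact hVw x
          · exact (maxIntegral_mono ih x).trans (maxIntegral_const_mul_le B w x)
        _ = w x + B * (r * M.maxIntegral w x) := by ring
        _ ≤ w x + B * (ρ * w x) := by
          gcongr w x + B * ?_
          exact hcontr x
        _ = ((1 + ρ * B : ℝ≥0) : ℝ≥0∞) * w x := by
          push_cast
          ring
        _ = B * w x := by rw [hB]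
  have hbound : ∀ n x, M.weightIter V r n x ≤ (B * C : ℝ≥0) * V x := by
    intro n x
    refine (hBw n x).trans ?_
    rw [ENNReal.coe_mul, mul_assoc]
    gcongr
    exact hwV x
  have hiter := hT.continuous_weightIter hWi hWii hV hbound
  have hgap : ∀ m n x, M.weightIter V r (n + m) x ≤
      M.weightIter V r n x + (ρ ^ n * B : ℝ≥0) * w x := by
    intro m n
    induction n with
    | zero =>
      intro x
      simpa [weightIter] using hBw m x
    | succ n ih =>
      intro x
      rw [Nat.add_right_comm]
      calc M.weightIter V r (n + m + 1) x
          = V x + r * M.maxIntegral (M.weightIter V r (n + m)) x := rfl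
        _ ≤ V x + r * (M.maxIntegral (M.weightIter V r n) x +
            (ρ ^ n * B : ℝ≥0) * M.maxIntegral w x) := by
          gcongr
          exact (maxIntegral_mono ih x).trans
            (maxIntegral_add_const_mul_le (hiter n).measurable _ w x)
        _ = M.weightIter V r (n + 1) x + (ρ ^ n * B : ℝ≥0) * (r * M.maxIntegral w x) := by
          simp only [weightIter]
          ring
        _ ≤ M.weightIter V r (n + 1) x + (ρ ^ n * B : ℝ≥0) * (ρ * w x) := by
          gcongr M.weightIter V r (n + 1) x + (ρ ^ n * B : ℝ≥0) * ?_
          exact hcontr x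
        _ = _ := by
          push_cast
          ring
  have hgap' : ∀ n x, M.totalWeight V r x ≤
      M.weightIter V r n x + (ρ ^ n * B : ℝ≥0) * w x := fun n x =>
    iSup_le fun m => (weightIter_mono V r (Nat.le_add_left m n) x).trans (hgap m n x)
  refine ⟨?_, B * C, fun x => iSup_le fun n => hbound n x⟩
  rw [continuous_iff_lower_upperSemicontinuous]
  refine ⟨lowerSemicontinuous_iSup fun n => (hiter n).lowerSemicontinuous, fun x t hxt => ?_⟩
  have hlim : Tendsto (fun n => M.totalWeight V r x + (ρ ^ n * B : ℝ≥0) * w x) atTop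
      (𝓝 (M.totalWeight V r x + ((0 * B : ℝ≥0) : ℝ≥0∞) * w x)) := by
    refine tendsto_const_nhds.add (ENNReal.Tendsto.mul_const ?_ (Or.inr (hwtop x)))
    rw [ENNReal.tendsto_coe]
    exact (NNReal.tendsto_pow_atTop_nhds_zero_of_lt_one hρ).mul_const B
  rw [zero_mul, ENNReal.coe_zero, zero_mul, add_zero] at hlim
  obtain ⟨n, hn⟩ := (hlim.eventually (Iio_mem_nhds hxt)).exists
  have hcn : Continuous fun x => M.weightIter V r n x + (ρ ^ n * B : ℝ≥0) * w x :=
    (hiter n).add ((ENNReal.continuous_const_mul ENNReal.coe_ne_top).comp hw)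
  have hn' : M.weightIter V r n x + (ρ ^ n * B : ℝ≥0) * w x < t := lt_of_le_of_lt
    (by gcongr; exact le_iSup (fun n => M.weightIter V r n x) n) hn
  filter_upwards [hcn.tendsto x (Iio_mem_nhds hn')] with y hy
  exact (hgap' n y).trans_lt hy

/-- Continuation in the factor `r`: for `w = totalWeight V r`, the operator with factor `r + δ` is
a contraction in the norm weighted by `w`, with `δ` independent of `r`. -/
lemma IsTransientBound.continuous_totalWeight_add (hT : M.IsTransientBound V K)
    (hWi : M.IsCompactContinuousAvail) (hWii : WeaklyContinuous M.kernel)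
    (hV : Continuous fun z : M.Gr => ∫⁻ y, (V y : ℝ≥0∞) ∂M.kernel z) {r δ : ℝ≥0} (hr : r ≤ 1)
    (hδ : 2 * (δ * K ^ 2) ≤ 1)
    (h : Continuous (M.totalWeight V r) ∧ ∃ C : ℝ≥0, ∀ x, M.totalWeight V r x ≤ C * V x) :
    Continuous (M.totalWeight V (r + δ)) ∧
      ∃ C : ℝ≥0, ∀ x, M.totalWeight V (r + δ) x ≤ C * V x := by
  obtain ⟨hcont, C, hC⟩ := h
  have hK := hT.totalWeight_le hWi hWii hV hr hcont hC
  have hiter := hT.continuous_weightIter hWi hWii hV (r := r) (C := C)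
    fun n x => (le_iSup (fun n => M.weightIter V r n x) n).trans (hC x)
  have hfix := totalWeight_eq fun n => (hiter n).measurable
  -- With `s = maxIntegral w` and `ρ = 1 - 1 / (2 K + 2)`, `(r + δ) s ≤ ρ (V + r s)` follows from
  -- `r s ≤ K V` and `δ s ≤ V / 2`.
  have hρ : (2 * K + 1) / (2 * K + 2) < 1 := by
    rw [div_lt_one (by positivity)]
    gcongr
    norm_num
  refine hT.continuous_totalWeight_of_contraction hWi hWii hV (r := r + δ) hρ hcont
    (le_totalWeight V r) hK fun x => ?_
  have hS : M.maxIntegral (M.totalWeight V r) x ≤ ((K * (K * V x) : ℝ≥0) : ℝ≥0∞) := by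
    push_cast
    calc M.maxIntegral (M.totalWeight V r) x ≤ M.maxIntegral (fun y => K * (V y : ℝ≥0∞)) x :=
        maxIntegral_mono hK x
      _ ≤ K * M.maxIntegral (fun y => V y) x := maxIntegral_const_mul_le K _ x
      _ ≤ K * (K * V x) := by
        gcongr
        exact hT.maxIntegral_le hWi hV x
  have hfx := hfix x
  have hKx := hK x
  generalize M.maxIntegral (M.totalWeight V r) x = s at *
  lift s to ℝ≥0 using ne_top_of_le_ne_top ENNReal.coe_ne_top hS
  rw [hfx] at hKx ⊢
  norm_cast at *
  rw [div_mul_eq_mul_div, le_div_iff₀ (by positivity)]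
  rw [← NNReal.coe_le_coe] at *
  push_cast at *
  have hδ' : (δ : ℝ) * s * 2 ≤ V x := by
    calc (δ : ℝ) * s * 2 ≤ δ * (K * (K * V x)) * 2 := by gcongr
      _ = 2 * (δ * K ^ 2) * V x := by ring
      _ ≤ 1 * V x := by gcongr
      _ = V x := one_mul _
  have h0 : 0 ≤ (K : ℝ) := K.2
  nlinarith [mul_le_mul_of_nonneg_left hδ' h0]

theorem IsTransientBound.exists_isHVWeight (hT : M.IsTransientBound V K)
    (hWi : M.IsCompactContinuousAvail) (hWii : WeaklyContinuous M.kernel)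
    (hV : Continuous fun z : M.Gr => ∫⁻ y, (V y : ℝ≥0∞) ∂M.kernel z) :
    ∃ μ : C(X, ℝ≥0), M.IsHVWeight V K μ := by
  obtain ⟨N, hN⟩ := exists_nat_ge (2 * K ^ 2)
  -- The factor moves from `0` to `1` in steps of length `1 / (N + 1)`.
  have hstep : ∀ j : ℕ, j ≤ N + 1 → Continuous (M.totalWeight V (j / (N + 1))) ∧
      ∃ C : ℝ≥0, ∀ x, M.totalWeight V (j / (N + 1)) x ≤ C * V x := by
    intro j
    induction j with
    | zero =>
      intro _
      have h0 : M.totalWeight V ((0 : ℕ) / (N + 1)) = fun x => (V x : ℝ≥0∞) := by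
        funext x
        refine le_antisymm (iSup_le fun n => ?_) (le_totalWeight V _ x)
        cases n <;> simp [weightIter]
      rw [h0]
      exact ⟨ENNReal.continuous_coe.comp hT.continuous, 1, fun x => by simp⟩
    | succ j ih =>
      intro hj
      have hδ : 2 * ((1 / (N + 1) : ℝ≥0) * K ^ 2) ≤ 1 := by
        rw [div_mul_eq_mul_div, one_mul, ← mul_div_assoc, div_le_one (by positivity)]
        exact hN.trans (by simp)
      have := hT.continuous_totalWeight_add hWi hWii hV (r := j / (N + 1)) (δ := 1 / (N + 1))
        (by
          rw [div_le_one (by positivity)]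
          exact_mod_cast (Nat.le_succ j).trans hj) hδ (ih (by omega))
      rwa [← add_div, ← Nat.cast_add_one] at this
  obtain ⟨hcont, C, hC⟩ := hstep (N + 1) le_rfl
  have h1 : ((N + 1 : ℕ) : ℝ≥0) / (N + 1) = 1 := by
    push_cast
    exact div_self (by positivity)
  rw [h1] at hcont hC
  have hK := hT.totalWeight_le hWi hWii hV le_rfl hcont hC
  have hiter := hT.continuous_weightIter hWi hWii hV (r := 1) (C := C)
    fun n x => (le_iSup (fun n => M.weightIter V 1 n x) n).trans (hC x)
  have hfix := totalWeight_eq fun n => (hiter n).measurable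
  have htop : ∀ x, M.totalWeight V 1 x ≠ ⊤ := fun x => ne_top_of_le_ne_top
    (ENNReal.mul_ne_top ENNReal.coe_ne_top ENNReal.coe_ne_top) (hK x)
  refine ⟨⟨fun x => (M.totalWeight V 1 x).toNNReal,
    ENNReal.continuousOn_toNNReal.comp_continuous hcont htop⟩, ?_, ?_, ?_⟩
  · intro x
    rw [← ENNReal.coe_le_coe]
    simpa [htop x] using le_totalWeight (M := M) V 1 x
  · intro x
    rw [← ENNReal.coe_le_coe]
    simpa [htop x] using hK x
  · intro z
    have := hfix z.1.1
    rw [ENNReal.coe_one, one_mul] at this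
    simp only [ContinuousMap.coe_mk, ENNReal.coe_toNNReal (htop _)]
    rw [this]
    gcongr
    exact lintegral_le_maxIntegral _ z

end Weight

/-! ### The dynamic programming operator -/

section Operator

variable {X A : Type*} [MeasurableSpace X] [MeasurableSpace A] {M : MDP X A}

/-- `c(z) + β ∫ w(y) p(dy | z)`. -/
noncomputable def oneStep (M : MDP X A) (β : ℝ≥0) (w : X → ℝ≥0∞) (z : M.Gr) : ℝ≥0∞ :=
  M.cost z + β * ∫⁻ y, w y ∂M.kernel z

lemma oneStep_mono (β : ℝ≥0) : Monotone (M.oneStep β) := fun _ _ h z => by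
  unfold oneStep
  gcongr
  exact h _

/-- The discounted cost over `n` epochs under the stationary policy `φ`. -/
noncomputable def finiteCost (β : ℝ≥0) (φ : M.Stationary) : ℕ → X → ℝ≥0∞
  | 0, _ => 0
  | n + 1, x => M.oneStep β (finiteCost β φ n) (φ.pair x)

lemma measurable_finiteCost (β : ℝ≥0) (φ : M.Stationary) (n : ℕ) :
    Measurable (finiteCost β φ n) := by
  induction n with
  | zero => exact measurable_const
  | succ n ih =>
    exact (M.measurable_cost.coe_nnreal_ennreal.add (ih.lintegral_kernel.const_mul _)).comp
      (measurable_stationary_pair φ)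

lemma finiteCost_mono (β : ℝ≥0) (φ : M.Stationary) : Monotone (finiteCost β φ) := by
  refine monotone_nat_of_le_succ fun n => ?_
  induction n with
  | zero => exact fun x => zero_le
  | succ n ih => exact fun x => oneStep_mono β ih (φ.pair x)

lemma oneStep_iSup (β : ℝ≥0) {w : ℕ → X → ℝ≥0∞} (hw : ∀ n, Measurable (w n)) (hmono : Monotone w)
    (z : M.Gr) : M.oneStep β (fun x => ⨆ n, w n x) z = ⨆ n, M.oneStep β (w n) z := by
  unfold oneStep
  rw [lintegral_iSup hw hmono, ENNReal.mul_iSup, ENNReal.add_iSup]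

/-- Value iteration: the minimal discounted cost over `n` epochs. -/
noncomputable def valueIter (M : MDP X A) (β : ℝ≥0) : ℕ → X → ℝ≥0∞
  | 0, _ => 0
  | n + 1, x => ⨅ a : M.avail x, M.oneStep β (valueIter M β n) (M.pair x a a.2)

lemma valueIter_mono (β : ℝ≥0) : Monotone (M.valueIter β) := by
  refine monotone_nat_of_le_succ fun n => ?_
  induction n with
  | zero => exact fun x => zero_le
  | succ n ih => exact fun x => iInf_mono fun a => oneStep_mono β ih _

end Operator

/-! ### Laws of the state-action process -/

section PathLaw

variable {X A : Type*} [MeasurableSpace X] [MeasurableSpace A] {M : MDP X A}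

lemma measurable_extCost (M : MDP X A) : Measurable M.extCost := by
  classical
  have : M.extCost = fun z => if h : z ∈ M.Gr then M.cost ⟨z, h⟩ else 0 := by
    funext z
    unfold extCost
    split_ifs <;> rfl
  rw [this]
  exact Measurable.dite (f := fun z : M.Gr => M.cost z) (g := fun _ => 0) M.measurable_cost
    measurable_const M.measurableSet_gr

lemma extCost_of_mem {z : X × A} (h : z ∈ M.Gr) : M.extCost z = M.cost ⟨z, h⟩ := dif_pos h

lemma extKernel_of_mem {z : X × A} (h : z ∈ M.Gr) : M.extKernel z = M.kernel ⟨z, h⟩ := dif_pos h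

lemma isProbabilityMeasure_initLaw (π : M.Policy) (x : X) : IsProbabilityMeasure (initLaw π x) :=
  Measure.isProbabilityMeasure_map (by fun_prop)

variable [IsMarkovKernel M.kernel]

lemma lintegral_pathLaw_zero (π : M.Policy) (x : X) {H : X × A → ℝ≥0∞} (hH : Measurable H) :
    ∫⁻ ω, H (ω 0) ∂pathLaw π x = ∫⁻ a, H (x, a) ∂π.rule 0 (Fin.elim0, x) := by
  have := isProbabilityMeasure_initLaw π x
  let e := MeasurableEquiv.piUnique fun _ : Finset.Iic 0 => X × A
  have h1 : (pathLaw π x).map (Preorder.frestrictLe 0) = (initLaw π x).map e.symm := by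
    unfold pathLaw Kernel.trajMeasure
    rw [Measure.map_comp _ _ (by fun_prop), Kernel.traj_map_frestrictLe, Kernel.partialTraj_self,
      Measure.id_comp]
  have hHe : Measurable fun h => H (e h) := hH.comp e.measurable
  have h2 : ∫⁻ ω, H (ω 0) ∂pathLaw π x =
      ∫⁻ h, H (e h) ∂(pathLaw π x).map (Preorder.frestrictLe 0) := by
    rw [lintegral_map hHe (by fun_prop)]
    rfl
  rw [h2, h1, lintegral_map hHe e.symm.measurable]
  simp only [MeasurableEquiv.apply_symm_apply]
  rw [initLaw, lintegral_map hH (by fun_prop)]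

/-- The law of `(xₙ₊₁, aₙ₊₁)`, disintegrated along the history up to epoch `n`. -/
lemma lintegral_pathLaw_succ (π : M.Policy) (x : X) (n : ℕ) {H : X × A → ℝ≥0∞}
    (hH : Measurable H) :
    ∫⁻ ω, H (ω (n + 1)) ∂pathLaw π x =
      ∫⁻ ω, ∫⁻ y, ∫⁻ a, H (y, a)
        ∂π.rule (n + 1) (histSucc n (Preorder.frestrictLe n ω, y)) ∂M.extKernel (ω n)
        ∂pathLaw π x := by
  have := isProbabilityMeasure_initLaw π x
  have h1 : (pathLaw π x).map (Preorder.frestrictLe n) ⊗ₘ stepKernel π n =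
      (pathLaw π x).map fun ω => (Preorder.frestrictLe n ω, ω (n + 1)) :=
    Kernel.map_frestrictLe_trajMeasure_compProd_eq_map_trajMeasure
  have : IsProbabilityMeasure (pathLaw π x) := by
    unfold pathLaw
    infer_instance
  have hH2 : Measurable fun p : (Finset.Iic n → X × A) × X × A => H p.2 :=
    hH.comp measurable_snd
  have h2 : ∫⁻ ω, H (ω (n + 1)) ∂pathLaw π x =
      ∫⁻ p, H p.2 ∂((pathLaw π x).map fun ω => (Preorder.frestrictLe n ω, ω (n + 1))) := by
    rw [lintegral_map hH2 (by fun_prop)]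
  have hm : Measurable fun h : Finset.Iic n → X × A => ∫⁻ z, H z ∂stepKernel π n h :=
    hH.lintegral_kernel
  rw [h2, ← h1, Measure.lintegral_compProd hH2, lintegral_map hm (by fun_prop)]
  refine lintegral_congr fun ω => ?_
  rw [stepKernel, Kernel.lintegral_compProd _ _ _ hH]
  rfl

/-- The law of `xₙ₊₁` is obtained from that of `(xₙ, aₙ)` by the transition kernel. -/
lemma lintegral_pathLaw_succ_fst (π : M.Policy) (x : X) (n : ℕ) {w : X → ℝ≥0∞}
    (hw : Measurable w) :
    ∫⁻ ω, w (ω (n + 1)).1 ∂pathLaw π x =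
      ∫⁻ ω, ∫⁻ y, w y ∂M.extKernel (ω n) ∂pathLaw π x := by
  rw [lintegral_pathLaw_succ π x n (H := fun z => w z.1) (hw.comp measurable_fst)]
  simp

/-- Under every policy the pairs visited are almost surely feasible. -/
lemma ae_pathLaw_mem_gr (π : M.Policy) (x : X) (n : ℕ) :
    ∀ᵐ ω ∂pathLaw π x, ω n ∈ M.Gr := by
  have hind : Measurable (M.Grᶜ.indicator (1 : X × A → ℝ≥0∞)) :=
    measurable_one.indicator M.measurableSet_gr.compl
  have hrule : ∀ m (h : Hist X A m), ∫⁻ a, M.Grᶜ.indicator 1 (h.2, a) ∂π.rule m h = 0 := by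
    intro m h
    have h1 : ∀ a, M.Grᶜ.indicator (1 : X × A → ℝ≥0∞) (h.2, a) =
        (M.avail h.2)ᶜ.indicator 1 a := fun a => rfl
    simp_rw [h1]
    rw [lintegral_indicator_one (M.measurableSet_avail h.2).compl,
      prob_compl_eq_zero_iff (M.measurableSet_avail h.2)]
    exact π.feasible m h
  have h0 : ∫⁻ ω, M.Grᶜ.indicator 1 (ω n) ∂pathLaw π x = 0 := by
    cases n with
    | zero =>
      rw [lintegral_pathLaw_zero π x hind]
      exact hrule 0 (Fin.elim0, x)
    | succ n =>
      rw [lintegral_pathLaw_succ π x n hind]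
      have h1 : ∀ (ω : ℕ → X × A) (y : X), ∫⁻ a, M.Grᶜ.indicator 1 (y, a)
          ∂π.rule (n + 1) (histSucc n (Preorder.frestrictLe n ω, y)) = 0 := fun ω y =>
        hrule (n + 1) (histSucc n (Preorder.frestrictLe n ω, y))
      simp [h1]
  have hindn : Measurable fun ω : ℕ → X × A => M.Grᶜ.indicator (1 : X × A → ℝ≥0∞) (ω n) :=
    hind.comp (measurable_pi_apply n)
  rw [lintegral_eq_zero_iff hindn] at h0
  filter_upwards [h0] with ω hω
  by_contra hmem
  simp [indicator_of_mem (show ω n ∈ M.Grᶜ from hmem)] at hω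

/-- Under a stationary policy `φ`, the pairs `(xₙ, aₙ)` and `(xₙ, φ xₙ)` have the same law. -/
lemma lintegral_pathLaw_stationary (φ : M.Stationary) (x : X) (n : ℕ) {H : X × A → ℝ≥0∞}
    (hH : Measurable H) :
    ∫⁻ ω, H (ω n) ∂pathLaw φ.toPolicy x =
      ∫⁻ ω, H ((ω n).1, φ.act (ω n).1) ∂pathLaw φ.toPolicy x := by
  have hH' : Measurable fun y => H (y, φ.act y) :=
    hH.comp (measurable_id.prodMk φ.measurable_act)
  have hrule : ∀ m (h : Hist X A m) (y : X), ∫⁻ a, H (y, a) ∂φ.toPolicy.rule m h =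
      H (y, φ.act h.2) := fun m h y =>
    Kernel.lintegral_deterministic' (φ.measurable_act.comp measurable_snd)
      (hH.comp measurable_prodMk_left)
  cases n with
  | zero =>
    rw [lintegral_pathLaw_zero _ x hH, lintegral_pathLaw_zero _ x
      (H := fun z => H (z.1, φ.act z.1)) (hH'.comp measurable_fst), hrule]
    simp
  | succ n =>
    rw [lintegral_pathLaw_succ _ x n hH, lintegral_pathLaw_succ_fst _ x n hH']
    refine lintegral_congr fun ω => lintegral_congr fun y => ?_
    rw [hrule]
    rfl

/-! ### Discounted costs -/

lemma discountedCost_eq_iSup (β : ℝ≥0) (π : M.Policy) (x : X) :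
    discountedCost β π x =
      ⨆ n, ∑ j ∈ Finset.range n, (β : ℝ≥0∞) ^ j * ∫⁻ ω, M.extCost (ω j) ∂pathLaw π x := by
  have hm : ∀ j, Measurable fun ω : ℕ → X × A => (M.extCost (ω j) : ℝ≥0∞) := fun j =>
    (M.measurable_extCost.comp (measurable_pi_apply j)).coe_nnreal_ennreal
  rw [discountedCost, lintegral_tsum fun j => ((hm j).const_mul _).aemeasurable,
    ENNReal.tsum_eq_iSup_nat]
  simp_rw [lintegral_const_mul _ (hm _)]

/-- Integrating `extCost + β ∫ w d extKernel` along the path gives the cost of epoch `j` plus the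
discounted expectation of `w` at the next state. -/
lemma lintegral_oneStep_ext (β : ℝ≥0) (π : M.Policy) (x : X) (j : ℕ) {w : X → ℝ≥0∞}
    (hw : Measurable w) :
    ∫⁻ ω, (M.extCost (ω j) + β * ∫⁻ y, w y ∂M.extKernel (ω j)) ∂pathLaw π x =
      ∫⁻ ω, M.extCost (ω j) ∂pathLaw π x + β * ∫⁻ ω, w (ω (j + 1)).1 ∂pathLaw π x := by
  have h1 : Measurable fun ω : ℕ → X × A => (M.extCost (ω j) : ℝ≥0∞) :=
    (M.measurable_extCost.comp (measurable_pi_apply j)).coe_nnreal_ennreal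
  rw [lintegral_add_left h1, lintegral_const_mul' _ _ ENNReal.coe_ne_top,
    lintegral_pathLaw_succ_fst π x j hw]

/-- Lower bound on the cost of an arbitrary policy over `n` epochs, by backward induction. -/
lemma le_sum_lintegral_extCost {β : ℝ≥0} {w : ℕ → X → ℝ≥0∞} (hw : ∀ n, Measurable (w n))
    (h0 : w 0 = 0) (hstep : ∀ n (z : M.Gr), w (n + 1) z.1.1 ≤ M.oneStep β (w n) z)
    (π : M.Policy) (x : X) (n : ℕ) :
    w n x ≤ ∑ j ∈ Finset.range n, (β : ℝ≥0∞) ^ j * ∫⁻ ω, M.extCost (ω j) ∂pathLaw π x := by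
  have key : ∀ k i, ∫⁻ ω, w k (ω i).1 ∂pathLaw π x ≤
      ∑ j ∈ Finset.range k, (β : ℝ≥0∞) ^ j * ∫⁻ ω, M.extCost (ω (i + j)) ∂pathLaw π x := by
    intro k
    induction k with
    | zero => simp [h0]
    | succ k ih =>
      intro i
      have h1 : ∫⁻ ω, w (k + 1) (ω i).1 ∂pathLaw π x ≤
          ∫⁻ ω, (M.extCost (ω i) + β * ∫⁻ y, w k y ∂M.extKernel (ω i)) ∂pathLaw π x := by
        refine lintegral_mono_ae ?_
        filter_upwards [ae_pathLaw_mem_gr π x i] with ω hω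
        rw [extCost_of_mem hω, extKernel_of_mem hω]
        exact hstep k ⟨ω i, hω⟩
      refine h1.trans ?_
      rw [lintegral_oneStep_ext β π x i (hw k), Finset.sum_range_succ', add_comm]
      simp only [pow_zero, one_mul, add_zero]
      gcongr
      refine (mul_le_mul_right (ih (i + 1)) _).trans_eq ?_
      rw [Finset.mul_sum]
      refine Finset.sum_congr rfl fun j _ => ?_
      rw [pow_succ', mul_assoc, add_right_comm, add_assoc]
  refine le_trans (le_of_eq ?_) ((key n 0).trans_eq (by simp))
  rw [lintegral_pathLaw_zero π x (H := fun z => w n z.1) ((hw n).comp measurable_fst)]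
  simp

lemma finiteCost_eq_sum (β : ℝ≥0) (φ : M.Stationary) (x : X) (n : ℕ) :
    finiteCost β φ n x = ∑ j ∈ Finset.range n,
      (β : ℝ≥0∞) ^ j * ∫⁻ ω, M.extCost (ω j) ∂pathLaw φ.toPolicy x := by
  have hw := measurable_finiteCost β φ
  have key : ∀ k i, ∫⁻ ω, finiteCost β φ k (ω i).1 ∂pathLaw φ.toPolicy x =
      ∑ j ∈ Finset.range k,
        (β : ℝ≥0∞) ^ j * ∫⁻ ω, M.extCost (ω (i + j)) ∂pathLaw φ.toPolicy x := by
    intro k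
    induction k with
    | zero => simp [finiteCost]
    | succ k ih =>
      intro i
      have h1 : ∫⁻ ω, finiteCost β φ (k + 1) (ω i).1 ∂pathLaw φ.toPolicy x =
          ∫⁻ ω, (M.extCost (ω i) + β * ∫⁻ y, finiteCost β φ k y ∂M.extKernel (ω i))
            ∂pathLaw φ.toPolicy x := by
        rw [lintegral_pathLaw_stationary φ x i
          (H := fun z => M.extCost z + β * ∫⁻ y, finiteCost β φ k y ∂M.extKernel z)
          (M.measurable_extCost.coe_nnreal_ennreal.add ((hw k).lintegral_kernel.const_mul _))]
        refine lintegral_congr fun ω => ?_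
        rw [extCost_of_mem (φ.mem_avail _), extKernel_of_mem (φ.mem_avail _)]
        rfl
      rw [h1, lintegral_oneStep_ext β _ x i (hw k), Finset.sum_range_succ', add_comm, ih (i + 1),
        Finset.mul_sum]
      simp only [pow_zero, one_mul, add_zero]
      congr 1
      refine Finset.sum_congr rfl fun j _ => ?_
      rw [pow_succ', mul_assoc, add_right_comm, add_assoc]
  have h := key n 0
  rw [lintegral_pathLaw_zero _ x (H := fun z => finiteCost β φ n z.1)
    ((hw n).comp measurable_fst)] at h
  simpa using h

lemma discountedCost_stationary (β : ℝ≥0) (φ : M.Stationary) (x : X) :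
    discountedCost β φ.toPolicy x = ⨆ n, finiteCost β φ n x := by
  rw [discountedCost_eq_iSup]
  exact iSup_congr fun n => (finiteCost_eq_sum β φ x n).symm

/-- The cost of a stationary policy solves the policy evaluation equation. -/
lemma discountedCost_stationary_eq_oneStep (β : ℝ≥0) (φ : M.Stationary) (x : X) :
    discountedCost β φ.toPolicy x = M.oneStep β (discountedCost β φ.toPolicy) (φ.pair x) := by
  have h : discountedCost β φ.toPolicy = fun x => ⨆ n, finiteCost β φ n x :=
    funext (discountedCost_stationary β φ)
  rw [h, oneStep_iSup β (measurable_finiteCost β φ) (finiteCost_mono β φ)]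
  exact (((finiteCost_mono β φ).apply₂ x).iSup_nat_add 1).symm

/-- The cost of a stationary policy is the least nonnegative supersolution of the policy
evaluation equation. -/
lemma discountedCost_stationary_le {β : ℝ≥0} {φ : M.Stationary} {w : X → ℝ≥0∞}
    (hw : ∀ x, M.oneStep β w (φ.pair x) ≤ w x) (x : X) :
    discountedCost β φ.toPolicy x ≤ w x := by
  have key : ∀ n, finiteCost β φ n ≤ w := by
    intro n
    induction n with
    | zero => exact fun x => zero_le
    | succ n ih => exact fun x => (oneStep_mono β ih (φ.pair x)).trans (hw x)
  rw [discountedCost_stationary]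
  exact iSup_le fun n => key n x

/-- A stationary policy is optimal if and only if it attains the value function in the optimality
equation. -/
lemma isDiscountOptimal_stationary_iff {β : ℝ≥0} (φ : M.Stationary) :
    IsDiscountOptimal β φ.toPolicy ↔
      ∀ x, M.discountedValue β x = M.oneStep β (M.discountedValue β) (φ.pair x) := by
  constructor
  · intro hφ x
    have : discountedCost β φ.toPolicy = M.discountedValue β := funext hφ
    rw [← this]
    exact discountedCost_stationary_eq_oneStep β φ x
  · intro hφ x
    exact le_antisymm (discountedCost_stationary_le (fun x => (hφ x).ge) x)
      (iInf_le _ φ.toPolicy)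

end PathLaw

/-! ### The optimality equation -/

section Optimality

variable {X A : Type*}
    [TopologicalSpace X] [TopologicalSpace.MetrizableSpace X]
    [MeasurableSpace X] [BorelSpace X] [TopologicalSpace A] [MeasurableSpace A]
    {M : MDP X A} [IsMarkovKernel M.kernel] {β : ℝ≥0}

lemma lowerSemicontinuous_oneStep (hcost : LowerSemicontinuous fun z => (M.cost z : ℝ≥0∞))
    (hker : WeaklyContinuous M.kernel) {w : X → ℝ≥0∞} (hw : LowerSemicontinuous w) :
    LowerSemicontinuous (M.oneStep β w) :=
  hcost.add ((ENNReal.continuous_const_mul ENNReal.coe_ne_top).comp_lowerSemicontinuous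
    (hker.lowerSemicontinuous_lintegral hw) fun _ _ h => mul_le_mul_right h _)

lemma IsCompactContinuousAvail.lowerSemicontinuous_valueIter (h : M.IsCompactContinuousAvail)
    (hcost : LowerSemicontinuous fun z => (M.cost z : ℝ≥0∞)) (hker : WeaklyContinuous M.kernel)
    (n : ℕ) : LowerSemicontinuous (M.valueIter β n) := by
  induction n with
  | zero => exact lowerSemicontinuous_const
  | succ n ih => exact h.lowerSemicontinuous_iInf (lowerSemicontinuous_oneStep hcost hker ih)

variable [TopologicalSpace.MetrizableSpace A] [SecondCountableTopology A] [BorelSpace A]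

/-- Value iteration converges to the value function, and some stationary policy is optimal. -/
lemma IsCompactContinuousAvail.exists_isDiscountOptimal (h : M.IsCompactContinuousAvail)
    (hcost : LowerSemicontinuous fun z => (M.cost z : ℝ≥0∞)) (hker : WeaklyContinuous M.kernel) :
    (M.discountedValue β = fun x => ⨆ n, M.valueIter β n x) ∧
      ∃ φ : M.Stationary, IsDiscountOptimal β φ.toPolicy := by
  have hlsc := h.lowerSemicontinuous_valueIter (β := β) hcost hker
  let w : X → ℝ≥0∞ := fun x => ⨆ n, M.valueIter β n x
  have hw : LowerSemicontinuous w := lowerSemicontinuous_iSup hlsc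
  have hbellman : ∀ x, w x = ⨅ a : M.avail x, M.oneStep β w (M.pair x a a.2) := by
    intro x
    simp only [w, oneStep_iSup β (fun n => (hlsc n).measurable) (valueIter_mono β)]
    rw [h.iInf_iSup_eq (f := fun n z => M.oneStep β (M.valueIter β n) z)
      (fun n => lowerSemicontinuous_oneStep hcost hker (hlsc n))
      fun _ _ hnm z => oneStep_mono β (valueIter_mono β hnm) z]
    exact (((valueIter_mono β).apply₂ x).iSup_nat_add 1).symm
  have hlower : ∀ (π : M.Policy) x, w x ≤ discountedCost β π x := by
    intro π x
    rw [discountedCost_eq_iSup]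
    exact iSup_mono fun n => le_sum_lintegral_extCost (fun n => (hlsc n).measurable) rfl
      (fun n z => iInf_le (fun a : M.avail z.1.1 =>
        M.oneStep β (M.valueIter β n) (M.pair z.1.1 a a.2)) ⟨z.1.2, z.2⟩) π x n
  obtain ⟨φ, hφ⟩ := h.exists_stationary_eq_iInf (lowerSemicontinuous_oneStep (β := β) hcost hker hw)
  have hupper : ∀ x, discountedCost β φ.toPolicy x ≤ w x := discountedCost_stationary_le fun x =>
    (hφ x).le.trans (hbellman x).ge
  have hval : M.discountedValue β = w := funext fun x =>
    le_antisymm ((iInf_le _ φ.toPolicy).trans (hupper x)) (le_iInf fun π => hlower π x)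
  refine ⟨hval, φ, fun x => ?_⟩
  rw [hval]
  exact le_antisymm (hupper x) (hlower _ x)

lemma IsCompactContinuousAvail.discountedValue_le_oneStep (h : M.IsCompactContinuousAvail)
    (hcost : LowerSemicontinuous fun z => (M.cost z : ℝ≥0∞)) (hker : WeaklyContinuous M.kernel)
    (z : M.Gr) : M.discountedValue β z.1.1 ≤ M.oneStep β (M.discountedValue β) z := by
  rw [(h.exists_isDiscountOptimal hcost hker).1]
  refine iSup_le fun n => (valueIter_mono β n.le_succ z.1.1).trans ?_
  refine (iInf_le (fun a : M.avail z.1.1 =>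
    M.oneStep β (M.valueIter β n) (M.pair z.1.1 a a.2)) ⟨z.1.2, z.2⟩).trans ?_
  exact oneStep_mono β (fun y => le_iSup (fun n => M.valueIter β n y) n) z

end Optimality

/-! ### The Hoffman-Veinott transformation -/

lemma metrizableSpace_sum_unit (S : Type*) [TopologicalSpace S]
    [TopologicalSpace.MetrizableSpace S] : TopologicalSpace.MetrizableSpace (S ⊕ Unit) := by
  let _ := TopologicalSpace.metrizableSpaceMetric S
  let _ : MetricSpace Unit := inferInstance
  let _ : MetricSpace (S ⊕ Unit) := Metric.metricSpaceSum
  exact inferInstance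

lemma borelSpace_sum_unit (S : Type*) [TopologicalSpace S] [MeasurableSpace S] [BorelSpace S] :
    BorelSpace (S ⊕ Unit) := by
  refine ⟨le_antisymm (fun s hs => ?_) (MeasurableSpace.generateFrom_le fun s hs => ?_)⟩
  · -- A set is the union of the images of its traces under two open, hence Borel, embeddings.
    let _ : MeasurableSpace (S ⊕ Unit) := borel _
    have : BorelSpace (S ⊕ Unit) := ⟨rfl⟩
    obtain ⟨h1, h2⟩ := measurableSet_sum_iff.1 hs
    rw [← image_preimage_inl_union_image_preimage_inr s]
    exact (IsOpenEmbedding.inl.measurableEmbedding.measurableSet_image.2 h1).union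
      (IsOpenEmbedding.inr.measurableEmbedding.measurableSet_image.2 h2)
  · obtain ⟨h1, h2⟩ := isOpen_sum_iff.1 hs
    exact measurableSet_sum_iff.2 ⟨h1.measurableSet, h2.measurableSet⟩

section Split

variable {X A : Type*} [MeasurableSpace X] [MeasurableSpace A] [TopologicalSpace X]
  [TopologicalSpace A] (M : MDP X A)

lemma continuous_hvSplit : Continuous M.hvSplit := by
  refine continuous_def.2 fun s hs => ?_
  obtain ⟨hl, -⟩ := isOpen_sum_iff.1 hs
  obtain ⟨t, ht, hts⟩ := isOpen_induced_iff.1 hl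
  have key : M.hvSplit ⁻¹' s = Subtype.val ⁻¹'
      (Prod.map Sum.inl Sum.inl '' t ∪ {z : (X ⊕ Unit) × (A ⊕ Unit) |
        z.1 ∈ Set.range Sum.inr ∧ Sum.inr () ∈ s}) := by
    ext ⟨⟨x, a⟩, h⟩
    rcases x with x | x
    · rcases a with a | a
      · have hxa : (x, a) ∈ M.Gr := by simpa [hvAvail] using h
        have h1 := Set.ext_iff.1 hts ⟨(x, a), hxa⟩
        constructor
        · intro h2
          exact Or.inl ⟨(x, a), h1.2 h2, rfl⟩
        · rintro (⟨⟨x', a'⟩, h2, h3⟩ | ⟨⟨y, hy⟩, -⟩)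
          · simp only [Prod.map_apply, Prod.mk.injEq, Sum.inl.injEq] at h3
            obtain ⟨rfl, rfl⟩ := h3
            exact h1.1 h2
          · simp at hy
      · simp [hvAvail] at h
    · constructor
      · intro h2
        exact Or.inr ⟨⟨x, rfl⟩, h2⟩
      · rintro (⟨⟨y, b⟩, -, h3⟩ | ⟨-, h2⟩)
        · simp at h3
        · exact h2
  rw [key]
  refine (IsOpen.union ((isOpenMap_inl.prodMap isOpenMap_inl) t ht) ?_).preimage
    continuous_subtype_val
  exact (isOpen_range_inr.preimage continuous_fst).inter isOpen_const

end Split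

section WeightFunction

variable {X A : Type*} [TopologicalSpace X] [MeasurableSpace X] [MeasurableSpace A] {M : MDP X A}
  {V : X → ℝ≥0} {K : ℝ≥0} {μ : C(X, ℝ≥0)} {β : ℝ≥0}

lemma IsHVWeight.pos (hT : M.IsTransientBound V K) (hμ : M.IsHVWeight V K μ) (x : X) : 0 < μ x :=
  zero_lt_one.trans_le ((hT.one_le x).trans (hμ.le_weight x))

lemma IsHVWeight.lintegral_ne_top (hμ : M.IsHVWeight V K μ) (z : M.Gr) :
    ∫⁻ y, (μ y : ℝ≥0∞) ∂M.kernel z ≠ ⊤ :=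
  ne_top_of_le_ne_top ENNReal.coe_ne_top (le_add_self.trans (hμ.add_lintegral_le z))

/-- The total mass on `X` of the transition law of the transformed model is at most `1`. -/
lemma IsHVWeight.inv_mul_lintegral_le_one (hT : M.IsTransientBound V K) (hμ : M.IsHVWeight V K μ)
    (hβ : ((K : ℝ) - 1) / K ≤ (β : ℝ)) (z : M.Gr) :
    ((β * μ z.1.1)⁻¹ : ℝ≥0) * ∫⁻ y, (μ y : ℝ≥0∞) ∂M.kernel z ≤ 1 := by
  have hI := hμ.lintegral_ne_top z
  have hadd := hμ.add_lintegral_le z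
  have hμK := hμ.weight_le z.1.1
  have hV := hT.one_le z.1.1
  have hVμ := hμ.le_weight z.1.1
  generalize ∫⁻ y, (μ y : ℝ≥0∞) ∂M.kernel z = I at *
  lift I to ℝ≥0 using hI
  norm_cast at *
  -- For `β = 0` the factor is `0⁻¹ = 0`.
  rcases eq_or_ne β 0 with rfl | hβ0
  · simp
  have hβμ : 0 < β * μ z.1.1 := mul_pos (pos_of_ne_zero hβ0) (hμ.pos hT _)
  rw [inv_mul_le_iff₀ hβμ, mul_one]
  have hK : 0 < K := by
    by_contra hK
    have : K = 0 := by simpa using hK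
    simp only [this, zero_mul] at hμK
    exact absurd ((hμ.pos hT z.1.1).trans_le hμK) (lt_irrefl _)
  rw [← NNReal.coe_le_coe] at *
  push_cast at *
  have hK' : (0 : ℝ) < K := hK
  rw [div_le_iff₀ hK'] at hβ
  have hμ0 : (0 : ℝ) ≤ μ z.1.1 := (μ z.1.1).2
  -- `K I ≤ K μ - K V ≤ (K - 1) μ ≤ K β μ`
  refine le_of_mul_le_mul_left ?_ hK'
  nlinarith [mul_le_mul_of_nonneg_right hβ hμ0, mul_le_mul_of_nonneg_left hadd hK'.le]

end WeightFunction

section Transform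

variable {X A : Type*} [TopologicalSpace X] [MeasurableSpace X] [BorelSpace X]
  [MeasurableSpace A] {M : MDP X A} {V : X → ℝ≥0} {K : ℝ≥0} {μ : C(X, ℝ≥0)} {β : ℝ≥0}

lemma isMarkovKernel_hv (hT : M.IsTransientBound V K) (hμ : M.IsHVWeight V K μ)
    (hβ : ((K : ℝ) - 1) / K ≤ (β : ℝ)) : IsMarkovKernel (M.hv μ β).kernel := by
  refine ⟨fun z => ?_⟩
  change IsProbabilityMeasure
    (Sum.elim (M.hvLaw μ β) (fun _ => Measure.dirac (Sum.inr ())) (M.hvSplit z))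
  rcases M.hvSplit z with z | z
  · constructor
    simp only [Sum.elim_inl, hvLaw, Measure.add_apply, Measure.smul_apply,
      Measure.map_apply measurable_inl MeasurableSet.univ, preimage_univ,
      withDensity_apply _ MeasurableSet.univ, Measure.restrict_univ, measure_univ, smul_eq_mul,
      mul_one]
    exact add_tsub_cancel_of_le (hμ.inv_mul_lintegral_le_one hT hβ z)
  · simp only [Sum.elim_inr]
    infer_instance

lemma lintegral_hvLaw (z : M.Gr) {g : X ⊕ Unit → ℝ≥0∞} (hg : Measurable g) :
    ∫⁻ y, g y ∂M.hvLaw μ β z =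
      ((β * μ z.1.1)⁻¹ : ℝ≥0) * ∫⁻ y, μ y * g (Sum.inl y) ∂M.kernel z +
      (1 - ((β * μ z.1.1)⁻¹ : ℝ≥0) * ∫⁻ y, (μ y : ℝ≥0∞) ∂M.kernel z) * g (Sum.inr ()) := by
  have hgl : Measurable fun y => g (Sum.inl y) := hg.comp measurable_inl
  rw [hvLaw, lintegral_add_measure, lintegral_smul_measure, lintegral_smul_measure,
    lintegral_map hg measurable_inl, lintegral_withDensity_eq_lintegral_mul _
      μ.continuous.measurable.coe_nnreal_ennreal hgl, lintegral_dirac' _ hg]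
  rfl

variable [TopologicalSpace A]

lemma IsCompactContinuousAvail.hv (h : M.IsCompactContinuousAvail) :
    (M.hv μ β).IsCompactContinuousAvail where
  isCompact := by
    rintro (x | x)
    · exact (h.isCompact x).image continuous_inl
    · exact isCompact_singleton
  isOpen_upper U hU := by
    refine isOpen_sum_iff.2 ⟨?_, isOpen_discrete _⟩
    convert h.isOpen_upper _ (hU.preimage continuous_inl) using 1
    ext x
    exact image_subset_iff
  isOpen_lower U hU := by
    refine isOpen_sum_iff.2 ⟨?_, isOpen_discrete _⟩
    convert h.isOpen_lower _ (hU.preimage continuous_inl) using 1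
    ext x
    exact image_inter_nonempty_iff

lemma lowerSemicontinuous_hv_cost (hμ : ∀ x, 0 < μ x) (hc : LowerSemicontinuous M.cost) :
    LowerSemicontinuous fun z => ((M.hv μ β).cost z : ℝ≥0∞) := by
  have h1 : LowerSemicontinuous fun z : M.Gr => (μ z.1.1)⁻¹ * M.cost z := by
    intro z t ht
    have hμc : Continuous fun z : M.Gr => t * μ z.1.1 := by fun_prop
    have hiff : ∀ z : M.Gr, t < (μ z.1.1)⁻¹ * M.cost z ↔ t * μ z.1.1 < M.cost z := fun z => by
      rw [inv_mul_eq_div, lt_div_iff₀ (hμ _)]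
    obtain ⟨s, hs, hs'⟩ := exists_between ((hiff z).1 ht)
    filter_upwards [hμc.tendsto z (Iio_mem_nhds hs), hc z s hs'] with z' h2 h3
    exact (hiff z').2 (lt_trans h2 h3)
  have h2 : LowerSemicontinuous
      (Sum.elim (fun z : M.Gr => (μ z.1.1)⁻¹ * M.cost z) fun _ : Unit => 0) := by
    rw [lowerSemicontinuous_iff_isOpen_preimage]
    exact fun t => isOpen_sum_iff.2 ⟨h1.isOpen_preimage t, isOpen_discrete _⟩
  exact ENNReal.continuous_coe.comp_lowerSemicontinuous (h2.comp M.continuous_hvSplit)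
    ENNReal.coe_mono

/-- Weak continuity of a Markov kernel is tested on bounded nonnegative functions. -/
lemma weaklyContinuous_of_continuous_lintegral {S T : Type*} [TopologicalSpace S]
    [MeasurableSpace S] [TopologicalSpace T] [MeasurableSpace T] [OpensMeasurableSpace T]
    {κ : Kernel S T} [IsMarkovKernel κ]
    (h : ∀ (g : T → ℝ≥0) (C : ℝ≥0), Continuous g → (∀ t, g t ≤ C) →
      Continuous fun s => ∫⁻ t, (g t : ℝ≥0∞) ∂κ s) : WeaklyContinuous κ := by
  intro f
  let g : T → ℝ≥0 := fun t => (f t + ‖f‖).toNNReal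
  have hg : Continuous g := by fun_prop
  have hnonneg : ∀ t, 0 ≤ f t + ‖f‖ := fun t => by
    linarith [neg_abs_le (f t), f.norm_coe_le_norm t, Real.norm_eq_abs (f t)]
  have hgC : ∀ t, g t ≤ 2 * ‖f‖₊ := fun t => by
    rw [Real.toNNReal_le_iff_le_coe]
    push_cast
    linarith [le_abs_self (f t), f.norm_coe_le_norm t, Real.norm_eq_abs (f t)]
  have hcont := h g _ hg hgC
  have hfin : ∀ s, ∫⁻ t, (g t : ℝ≥0∞) ∂κ s ≠ ⊤ := fun s =>
    ne_top_of_le_ne_top (ENNReal.coe_ne_top (r := 2 * ‖f‖₊))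
      ((lintegral_mono fun t => ENNReal.coe_le_coe.2 (hgC t)).trans (by simp))
  have heq : ∀ s, ∫ t, f t ∂κ s = (∫⁻ t, (g t : ℝ≥0∞) ∂κ s).toReal - ‖f‖ := by
    intro s
    have h1 : ∫ t, (f t + ‖f‖) ∂κ s = (∫⁻ t, (g t : ℝ≥0∞) ∂κ s).toReal :=
      integral_eq_lintegral_of_nonneg_ae (Eventually.of_forall hnonneg)
        (f.continuous.measurable.add_const _).aestronglyMeasurable
    rw [← h1, integral_add (f.integrable _) (integrable_const _)]
    simp
  simp_rw [heq]
  exact (ENNReal.continuousOn_toReal.comp_continuous hcont hfin).sub continuous_const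

/-- The density `μ` is dominated by `K V`, whose integrals are continuous, so that integrals of
`μ g` are continuous for bounded continuous `g`. -/
lemma weaklyContinuous_hv_kernel [TopologicalSpace.MetrizableSpace X]
    [TopologicalSpace.MetrizableSpace A] [SecondCountableTopology A] [BorelSpace A]
    [IsFiniteKernel M.kernel] (hT : M.IsTransientBound V K)
    (hWi : M.IsCompactContinuousAvail) (hWii : WeaklyContinuous M.kernel)
    (hV : Continuous fun z : M.Gr => ∫⁻ y, (V y : ℝ≥0∞) ∂M.kernel z)
    (hμ : M.IsHVWeight V K μ) (hβ : ((K : ℝ) - 1) / K ≤ (β : ℝ)) :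
    WeaklyContinuous (M.hv μ β).kernel := by
  have := isMarkovKernel_hv hT hμ hβ
  have := borelSpace_sum_unit X
  refine weaklyContinuous_of_continuous_lintegral fun g C hg hC => ?_
  have hgm : Measurable fun y => (g y : ℝ≥0∞) := hg.measurable.coe_nnreal_ennreal
  have hμc : Continuous fun y => (μ y : ℝ≥0∞) := ENNReal.continuous_coe.comp μ.continuous
  have hμV : ∀ y, (μ y : ℝ≥0∞) ≤ K * V y := fun y => by exact_mod_cast hμ.weight_le y
  have hIμ : Continuous fun z : M.Gr => ∫⁻ y, (μ y : ℝ≥0∞) ∂M.kernel z :=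
    hT.continuous_lintegral hWi hWii hV hμc hμV
  have hIg : Continuous fun z : M.Gr => ∫⁻ y, μ y * (g (Sum.inl y) : ℝ≥0∞) ∂M.kernel z := by
    refine hT.continuous_lintegral hWi hWii hV (C := C * K) ?_ fun y => ?_
    · have : Continuous fun y => μ y * g (Sum.inl y) := by fun_prop
      simpa [Function.comp_def] using ENNReal.continuous_coe.comp this
    · rw [mul_comm, ENNReal.coe_mul, mul_assoc]
      gcongr
      · exact hC _
      · exact hμV y
  have hIgtop : ∀ z : M.Gr, ∫⁻ y, μ y * (g (Sum.inl y) : ℝ≥0∞) ∂M.kernel z ≠ ⊤ := by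
    intro z
    refine ne_top_of_le_ne_top (ENNReal.mul_ne_top (hμ.lintegral_ne_top z)
      (ENNReal.coe_ne_top (r := C))) ?_
    rw [← lintegral_mul_const' _ _ ENNReal.coe_ne_top]
    exact lintegral_mono fun y => by
      gcongr
      exact hC _
  have hinv : Continuous fun z : M.Gr => (β * μ z.1.1)⁻¹ := by
    rcases eq_or_ne β 0 with rfl | hβ0
    · simpa using continuous_const
    · have : Continuous fun z : M.Gr => β * μ z.1.1 := by fun_prop
      exact this.inv₀ fun z => (mul_pos (pos_of_ne_zero hβ0) (hμ.pos hT _)).ne'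
  have hinv' : Continuous fun z : M.Gr => (((β * μ z.1.1)⁻¹ : ℝ≥0) : ℝ≥0∞) :=
    ENNReal.continuous_coe.comp hinv
  have hlaw : Continuous fun z : M.Gr => ∫⁻ y, (g y : ℝ≥0∞) ∂M.hvLaw μ β z := by
    simp_rw [lintegral_hvLaw _ hgm]
    rw [continuous_iff_continuousAt]
    intro z
    refine (ENNReal.Tendsto.mul hinv'.continuousAt (Or.inr (hIgtop z)) hIg.continuousAt
      (Or.inr ENNReal.coe_ne_top)).add (ENNReal.Tendsto.mul_const
        (ENNReal.Tendsto.sub tendsto_const_nhds (ENNReal.Tendsto.mul hinv'.continuousAt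
          (Or.inr (hμ.lintegral_ne_top z)) hIμ.continuousAt (Or.inr ENNReal.coe_ne_top))
          (Or.inl ENNReal.one_ne_top)) (Or.inr ENNReal.coe_ne_top))
  have hsplit : ∀ z, ∫⁻ y, (g y : ℝ≥0∞) ∂(M.hv μ β).kernel z =
      Sum.elim (fun z : M.Gr => ∫⁻ y, (g y : ℝ≥0∞) ∂M.hvLaw μ β z)
        (fun _ => (g (Sum.inr ()) : ℝ≥0∞)) (M.hvSplit z) := by
    intro z
    change ∫⁻ y, (g y : ℝ≥0∞) ∂(Sum.elim (M.hvLaw μ β) (fun _ => Measure.dirac (Sum.inr ()))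
      (M.hvSplit z)) = _
    rcases M.hvSplit z with z | z
    · rfl
    · exact lintegral_dirac' _ hgm
  simp_rw [hsplit]
  exact (hlaw.sumElim continuous_const).comp M.continuous_hvSplit

end Transform

section Added

variable {X A : Type*} [TopologicalSpace X] [MeasurableSpace X] [BorelSpace X]
  [MeasurableSpace A] {M : MDP X A} {μ : C(X, ℝ≥0)} {β : ℝ≥0}

lemma hv_oneStep_inr (w : X ⊕ Unit → ℝ≥0∞) (hw : Measurable w)
    (z : (M.hv μ β).Gr) (hz : z.1.1 = Sum.inr ()) :
    (M.hv μ β).oneStep β w z = β * w (Sum.inr ()) := by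
  obtain ⟨⟨x, a⟩, h⟩ := z
  obtain rfl : x = Sum.inr () := hz
  have h1 : (M.hv μ β).cost ⟨(Sum.inr (), a), h⟩ = 0 := rfl
  have h2 : (M.hv μ β).kernel ⟨(Sum.inr (), a), h⟩ = Measure.dirac (Sum.inr ()) := rfl
  rw [oneStep, h1, h2, lintegral_dirac' _ hw]
  simp

/-- The added state is absorbing and free of cost. -/
lemma hv_discountedValue_inr [IsMarkovKernel (M.hv μ β).kernel] :
    (M.hv μ β).discountedValue β (Sum.inr ()) = 0 := by
  obtain ⟨φ, hφ, hmem⟩ := (M.hv μ β).exists_selector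
  let ψ : (M.hv μ β).Stationary := ⟨φ, hφ, hmem⟩
  have key : ∀ n, finiteCost β ψ n (Sum.inr ()) = 0 := by
    intro n
    induction n with
    | zero => rfl
    | succ n ih =>
      rw [finiteCost, hv_oneStep_inr _ (measurable_finiteCost β ψ n) _ rfl, ih, mul_zero]
  refine le_antisymm ((iInf_le _ ψ.toPolicy).trans ?_) zero_le
  rw [discountedCost_stationary]
  simp [key]

lemma hvOneStep_eq_oneStep [IsMarkovKernel (M.hv μ β).kernel] (z : (M.hv μ β).Gr) :
    M.hvOneStep μ β z = (M.hv μ β).oneStep β ((M.hv μ β).discountedValue β) z := by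
  have h : ∀ y, (M.hv μ β).discountedValue β y =
      (range Sum.inl).indicator ((M.hv μ β).discountedValue β) y := by
    rintro (y | ⟨⟩)
    · simp
    · simpa using hv_discountedValue_inr
  have h' : ∫⁻ y, (M.hv μ β).discountedValue β y ∂(M.hv μ β).kernel z =
      ∫⁻ y in range Sum.inl, (M.hv μ β).discountedValue β y ∂(M.hv μ β).kernel z := by
    rw [← lintegral_indicator measurableSet_range_inl]
    exact lintegral_congr h
  rw [hvOneStep, oneStep, h']

end Added

end MDP

theorem mainTheorem1 {X A : Type*}
    [TopologicalSpace X] [TopologicalSpace.MetrizableSpace X] [SecondCountableTopology X]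
    [MeasurableSpace X] [BorelSpace X] [StandardBorelSpace X]
    [TopologicalSpace A] [TopologicalSpace.MetrizableSpace A] [SecondCountableTopology A]
    [MeasurableSpace A] [BorelSpace A] [StandardBorelSpace A]
    (M : MDP X A) [IsFiniteKernel M.kernel] (V : X → ℝ≥0) (K : ℝ≥0)
    (hT : M.IsTransientBound V K)
    (hWi : M.IsCompactContinuousAvail)
    (hWii : MDP.WeaklyContinuous M.kernel)
    (hV : Continuous fun z : M.Gr => ∫⁻ y, (V y : ℝ≥0∞) ∂M.kernel z) :
    (∃ μ : C(X, ℝ≥0), M.IsHVWeight V K μ) ∧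
    ∀ μ : C(X, ℝ≥0), M.IsHVWeight V K μ →
    ∀ β : ℝ≥0, ((K : ℝ) - 1) / K ≤ (β : ℝ) → β < 1 →
      ∃ _ : IsMarkovKernel (M.hv μ β).kernel,
        MDP.WeaklyContinuous (M.hv μ β).kernel ∧
        (LowerSemicontinuous M.cost →
          (∃ φ : (M.hv μ β).Stationary, MDP.IsDiscountOptimal β φ.toPolicy) ∧
          ∀ φ : (M.hv μ β).Stationary,
            MDP.IsDiscountOptimal β φ.toPolicy ↔
              ∀ x : X,
                (M.hv μ β).discountedValue β (Sum.inl x) =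
                  M.hvOneStep μ β (φ.pair (Sum.inl x)) ∧
                IsLeast
                  {r | ∃ (a : A ⊕ Unit) (h : a ∈ (M.hv μ β).avail (Sum.inl x)),
                    r = M.hvOneStep μ β ((M.hv μ β).pair (Sum.inl x) a h)}
                  (M.hvOneStep μ β (φ.pair (Sum.inl x)))) := by
  refine ⟨hT.exists_isHVWeight hWi hWii hV, fun μ hμ β hβ _ => ?_⟩
  have hmarkov := MDP.isMarkovKernel_hv hT hμ hβ
  have hker := MDP.weaklyContinuous_hv_kernel hT hWi hWii hV hμ hβ
  refine ⟨hmarkov, hker, fun hc => ?_⟩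
  have := MDP.metrizableSpace_sum_unit X
  have := MDP.metrizableSpace_sum_unit A
  have := MDP.borelSpace_sum_unit X
  have := MDP.borelSpace_sum_unit A
  have hcost := MDP.lowerSemicontinuous_hv_cost (β := β) (hμ.pos hT) hc
  have hN : (M.hv μ β).IsCompactContinuousAvail := hWi.hv
  obtain ⟨hval, hopt⟩ := hN.exists_isDiscountOptimal (β := β) hcost hker
  refine ⟨hopt, fun φ => ?_⟩
  have hmeas : Measurable ((M.hv μ β).discountedValue β) := by
    rw [hval]
    exact (lowerSemicontinuous_iSup (hN.lowerSemicontinuous_valueIter hcost hker)).measurable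
  simp only [MDP.hvOneStep_eq_oneStep]
  rw [MDP.isDiscountOptimal_stationary_iff]
  constructor
  · intro h x
    refine ⟨h _, ⟨φ.act (Sum.inl x), φ.mem_avail _, rfl⟩, ?_⟩
    rintro _ ⟨a, ha, rfl⟩
    rw [← h]
    exact hN.discountedValue_le_oneStep hcost hker ((M.hv μ β).pair (Sum.inl x) a ha)
  · rintro h (x | ⟨⟩)
    · exact (h x).1
    · rw [MDP.hv_oneStep_inr _ hmeas _ rfl, MDP.hv_discountedValue_inr, mul_zero]
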